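/- Let $\mathcal X$ be a finite alphabet, let $P_1,P_2$ be probability distributions on $\mathcal X$, and let $\log$ be the natural logarithm. For $\alpha\ge 0$ let $$\mathrm{GJS}(P,Q,\alpha)=\alpha D(P\|P_\alpha)+D(Q\|P_\alpha),\qquad P_\alpha=\frac{\alpha P+Q}{1+\alpha},$$ where $D$ is the relative entropy, and let $C(P_1,P_2)=-\inf_{\eta\in[0,1]}\log\sum_{x\in\mathcal X}P_1(x)^{\eta}P_2(x)^{1-\eta}\in[0,\infty]$ be the Chernoff information. Let $0<\gamma\le C(P_1,P_2)$, $\gamma<\infty$; if $\gamma=C(P_1,P_2)$, assume that $P_1$ and $P_2$ have the same support. For $N\in\mathbb N$ let $X_1^N$ and $X_2^N$ be i.i.d. words of length $N$ drawn from $P_1$ and from $P_2$, and let $Y_1,Y_2,\dots$ be i.i.d. with law $P_i$ under hypothesis $H_i$ ($i\in\{1,2\}$), the three families being independent; $\mathrm P_i,\mathbb E_i$ are probability and expectation under $H_i$. Let $\mathsf T_w$ be the empirical distribution of a word $w$, and $S_j(n)=n\,\mathrm{GJS}(\mathsf T_{X_j^N},\mathsf T_{Y^n},N/n)$ for $n\ge1$.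 The sequential test $\Phi_{\rm seq}(\gamma)$ stops at $$T=\min\bigl(\inf\{n\ge 1: S_1(n)\ge\gamma N\ \text{or}\ S_2(n)\ge\gamma N\},\,N^2\bigr)$$ and decides $H_1$ if $S_2(T)\ge\gamma N>S_1(T)$ and $H_2$ if $S_1(T)\ge\gamma N>S_2(T)$; if both or neither of the scores reach $\gamma N$ at time $T$, its decision is an arbitrary function of $(X_1^N,X_2^N,Y^T)$. Let $\mathrm P_i^{\rm err}$ be the probability under $H_i$ that the decision is not $H_i$, and $$\mathsf e_i(\Phi_{\rm seq}(\gamma))=\liminf_{N\to\infty}\frac{-\log \mathrm P_i^{\rm err}}{\mathbb E_i[T]}\qquad(-\log 0=\infty).$$ Then each of the equations $\mathrm{GJS}(P_2,P_1,\beta)=\gamma\beta$ and $\mathrm{GJS}(P_1,P_2,\theta)=\gamma\theta$ has a unique positive solution, $\beta^\star_\gamma$ and $\theta^\star_\gamma$ respectively, and for every choice of the free decisions $\mathrm P_1^{\rm err}\to0$ and $\mathrm P_2^{\rm err}\to0$ as $N\to\infty$, and $$\mathsf e_1(\Phi_{\rm seq}(\gamma))\ge \mathrm{GJS}(P_2,P_1,\beta^\star_\gamma),\qquad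 \mathsf e_2(\Phi_{\rm seq}(\gamma))\ge \mathrm{GJS}(P_1,P_2,\theta^\star_\gamma).$$ -/

import Mathlib

open MeasureTheory Filter Topology
open scoped ENNReal

noncomputable section

namespace SeqClass

/-- The two hypotheses: the test sequence has the same source as the first (`H1`) or as the
second (`H2`) training sequence. -/
inductive Hyp : Type
  | H1
  | H2

variable {X : Type*} [Fintype X]

/-- The probability mass function of `P` as a vector of real numbers. -/
def pmfReal (P : PMF X) : X → ℝ := fun x => (P x).toReal

/-- The relative entropy (Kullback-Leibler divergence) `∑ p(x) log (p(x) / q(x))` in nats, with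
`0 log (0 / q) = 0`. It is only ever used where `q` vanishes nowhere on the support of `p`, or
with a coefficient `0`. -/
def relEntropy (p q : X → ℝ) : ℝ := ∑ x, p x * Real.log (p x / q x)

/-- The generalized Jensen-Shannon divergence
`α D(p ‖ m) + D(q ‖ m)` with `m = (α p + q) / (1 + α)`, for `α ≥ 0`. -/
def GJS (p q : X → ℝ) (α : ℝ) : ℝ :=
  α * relEntropy p (fun x => (α * p x + q x) / (1 + α)) +
    relEntropy q (fun x => (α * p x + q x) / (1 + α))

/-- The Chernoff information
`- inf_{η ∈ [0,1]} log ∑ P(x)^η Q(x)^(1-η)`; it is `⊤` if the supports are disjoint. -/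
def chernoff (P Q : PMF X) : EReal :=
  -(⨅ η ∈ Set.Icc (0 : ℝ) 1, ENNReal.log (∑ x, P x ^ η * Q x ^ (1 - η)))

open scoped Classical in
/-- The type (empirical distribution) of a word of length `n`. -/
def empirical {n : ℕ} (x : Fin n → X) : X → ℝ :=
  fun a => (1 / (n : ℝ)) * ∑ i, if x i = a then (1 : ℝ) else 0

/-- The score `n GJS(type of x, type of y, N / n)` of a training word `x` of length `N` against a
test word `y` of length `n`. -/
def score {N n : ℕ} (x : Fin N → X) (y : Fin n → X) : ℝ :=
  (n : ℝ) * GJS (empirical x) (empirical y) ((N : ℝ) / (n : ℝ))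

/-- The first `n` letters of a sequence. -/
def initial {A : Type*} (n : ℕ) (y : ℕ → A) : Fin n → A := fun k => y k

/-- A test with training words of length `N`: a stopping time `T` and a decision rule `d`.
The letters of the test sequence are `y 0, y 1, …`. The field `stopping` says that `T = n` is
decided by the training words and the first `n` letters of the test sequence, that is, `T` is
a stopping time of the filtration that they generate; the decision is a function of
the training words and of the `T` observed letters. -/
structure Test (A : Type*) (N : ℕ) where
  T : (Fin N → A) → (Fin N → A) → (ℕ → A) → ℕ
  stopping : ∀ (x₁ x₂ : Fin N → A) (y y' : ℕ → A),
    (∀ k < T x₁ x₂ y, y k = y' k) → T x₁ x₂ y' = T x₁ x₂ y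
  d : (Fin N → A) → (Fin N → A) → (n : ℕ) → (Fin n → A) → Hyp

/-- The source of the test sequence under a hypothesis. -/
def Hyp.source (P₁ P₂ : PMF X) : Hyp → PMF X
  | Hyp.H1 => P₁
  | Hyp.H2 => P₂

/-- The joint law under a hypothesis: training words i.i.d. from `P₁` and from `P₂`, test sequence
i.i.d. from the source that the hypothesis names, all independent. -/
def law [MeasurableSpace X] (P₁ P₂ : PMF X) (i : Hyp) (N : ℕ) :
    Measure ((Fin N → X) × (Fin N → X) × (ℕ → X)) :=
  (Measure.pi fun _ : Fin N => P₁.toMeasure).prod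
    ((Measure.pi fun _ : Fin N => P₂.toMeasure).prod
      (Measure.infinitePi fun _ : ℕ => (i.source P₁ P₂).toMeasure))

/-- The probability, under hypothesis `i`, that the test does not decide for `i`. -/
def errorProb [MeasurableSpace X] (P₁ P₂ : PMF X) (i : Hyp) {N : ℕ} (Φ : Test X N) : ℝ≥0∞ :=
  law P₁ P₂ i N {ω | Φ.d ω.1 ω.2.1 (Φ.T ω.1 ω.2.1 ω.2.2)
    (initial (Φ.T ω.1 ω.2.1 ω.2.2) ω.2.2) ≠ i}

/-- The expected number of test samples under hypothesis `i`. -/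
def expectedTime [MeasurableSpace X] (P₁ P₂ : PMF X) (i : Hyp) {N : ℕ} (Φ : Test X N) : ℝ≥0∞ :=
  ∫⁻ ω, (Φ.T ω.1 ω.2.1 ω.2.2 : ℝ≥0∞) ∂(law P₁ P₂ i N)

/-- The error exponent `liminf_N (- log P_i^err) / E_i[T]` of a family of tests, with
`- log 0 = ⊤`. -/
def errorExponent [MeasurableSpace X] (P₁ P₂ : PMF X) (i : Hyp) (Φ : (N : ℕ) → Test X N) :
    EReal :=
  liminf (fun N => -ENNReal.log (errorProb P₁ P₂ i (Φ N)) /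
    ((expectedTime P₁ P₂ i (Φ N) : ℝ≥0∞) : EReal)) atTop

/-- The times `n ≥ 1` at which one of the two scores is at least `γ N`. -/
def crossings (γ : ℝ) {N : ℕ} (x₁ x₂ : Fin N → X) (y : ℕ → X) : Set ℕ :=
  {n | 1 ≤ n ∧ (γ * N ≤ score x₁ (initial n y) ∨ γ * N ≤ score x₂ (initial n y))}

/-- The minimum of the first crossing time (infinite if there is none) and `N ^ 2`. -/
def seqTime (γ : ℝ) {N : ℕ} (x₁ x₂ : Fin N → X) (y : ℕ → X) : ℕ :=
  sInf (insert (N ^ 2) (crossings γ x₁ x₂ y))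

theorem seqTime_stopping (γ : ℝ) {N : ℕ} (x₁ x₂ : Fin N → X) (y y' : ℕ → X)
    (h : ∀ k < seqTime γ x₁ x₂ y, y k = y' k) :
    seqTime γ x₁ x₂ y' = seqTime γ x₁ x₂ y := by
  have key : ∀ n ≤ seqTime γ x₁ x₂ y, initial n y = initial n y' := by
    intro n hn
    funext k
    exact h k (lt_of_lt_of_le k.2 hn)
  have mem : ∀ z : ℕ → X, seqTime γ x₁ x₂ z ∈ insert (N ^ 2) (crossings γ x₁ x₂ z) :=
    fun z => Nat.sInf_mem (Set.insert_nonempty _ _)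
  have tr : ∀ n ≤ seqTime γ x₁ x₂ y, (n ∈ insert (N ^ 2) (crossings γ x₁ x₂ y) ↔
      n ∈ insert (N ^ 2) (crossings γ x₁ x₂ y')) := by
    intro n hn
    simp only [Set.mem_insert_iff, crossings, Set.mem_ofPred_eq, key n hn]
  have h1 : seqTime γ x₁ x₂ y' ≤ seqTime γ x₁ x₂ y :=
    Nat.sInf_le ((tr _ le_rfl).1 (mem y))
  exact le_antisymm h1 (Nat.sInf_le ((tr _ h1).2 (mem y')))

/-- The decision rules of the sequential test: decide for `H1` if the score of the second class
(only) has reached `γ N`, and for `H2` if the score of the first class (only) has. The decision is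
left free where both scores or neither have reached it. -/
def IsSeqRule (γ : ℝ) {N : ℕ}
    (d : (Fin N → X) → (Fin N → X) → (n : ℕ) → (Fin n → X) → Hyp) : Prop :=
  ∀ (x₁ x₂ : Fin N → X) (n : ℕ) (y : Fin n → X),
    (γ * N ≤ score x₂ y → ¬ γ * N ≤ score x₁ y → d x₁ x₂ n y = Hyp.H1) ∧
    (γ * N ≤ score x₁ y → ¬ γ * N ≤ score x₂ y → d x₁ x₂ n y = Hyp.H2)

/-- The sequential test with threshold `γ` and decision rule `d`. -/
def seqTest (γ : ℝ) {N : ℕ}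
    (d : (Fin N → X) → (Fin N → X) → (n : ℕ) → (Fin n → X) → Hyp) : Test X N where
  T := seqTime γ
  stopping := seqTime_stopping γ
  d := d

/-- `α` is the unique positive solution of `GJS(P, Q, α) = γ α`. -/
def IsTheSolution (P Q : PMF X) (γ α : ℝ) : Prop :=
  0 < α ∧ GJS (pmfReal P) (pmfReal Q) α = γ * α ∧
    ∀ a : ℝ, 0 < a → GJS (pmfReal P) (pmfReal Q) a = γ * a → a = α

end SeqClass

end

/-!
Under `H1` the test can err only if the first score reaches `γN`, or if the second score is still
below `γN` at time `N²`. By the method of types the first event has probability at most `exp (-γN)`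
up to a polynomial factor. In the second event the type `t` of `X₂ᴺ` nearly satisfies
`D(t‖P₁) < γ`, the type of `Y` being close to `P₁` except with probability exponentially small in
`N²`. Some `η ∈ (0, 1)` has `∑ P₁ ^ η * P₂ ^ (1 - η) ≤ exp (-γ)`, so Gibbs' inequality gives
`η D(t‖P₁) + (1 - η) D(t‖P₂) ≥ γ`, and `D(t‖P₂)` is nearly at least `γ`: apply Sanov's bound.
On the other hand, at time `τN` the second score concentrates around `τN · GJS(P₂, P₁, 1/τ)`, which
exceeds `γN` when `τ > 1/β`, so `E[T]` is at most `N/β` to first order. The exponent is therefore at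
least `γβ = GJS(P₂, P₁, β)`, and exchanging the training sequences gives `H2`.
-/

noncomputable section

namespace SeqClass

open Function (support)
open ExpGrowth LinearGrowth

section RelEntropy

variable {X : Type*} [Fintype X] {p q v w : X → ℝ}

theorem pmfReal_mem_stdSimplex (P : PMF X) : pmfReal P ∈ stdSimplex ℝ X := by
  refine ⟨fun _ => ENNReal.toReal_nonneg, ?_⟩
  simp only [pmfReal]
  rw [← ENNReal.toReal_sum fun a _ => P.apply_ne_top a, ← tsum_fintype (L := .unconditional X),
    P.tsum_coe, ENNReal.toReal_one]

theorem relEntropy_self (p : X → ℝ) : relEntropy p p = 0 := by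
  refine Finset.sum_eq_zero fun x _ => ?_
  by_cases hx : p x = 0 <;> simp [hx]

theorem relEntropy_eq_sum_klFun (hpq : support p ⊆ support q) (hsum : ∑ x, p x = ∑ x, q x) :
    relEntropy p q = ∑ x, q x * InformationTheory.klFun (p x / q x) := by
  have hterm : ∀ x, q x * InformationTheory.klFun (p x / q x) =
      p x * Real.log (p x / q x) + (q x - p x) := by
    intro x
    by_cases hq : q x = 0
    · have hp : p x = 0 := by_contra fun hp => hpq hp hq
      simp [hp, hq]
    · rw [InformationTheory.klFun_apply]
      field_simp
      ring
  simp only [hterm, Finset.sum_add_distrib, Finset.sum_sub_distrib, hsum, sub_self, add_zero,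
    relEntropy]

theorem relEntropy_nonneg (hp : p ∈ stdSimplex ℝ X) (hq : q ∈ stdSimplex ℝ X)
    (hpq : support p ⊆ support q) : 0 ≤ relEntropy p q := by
  rw [relEntropy_eq_sum_klFun hpq (hp.2.trans hq.2.symm)]
  exact Finset.sum_nonneg fun x _ =>
    mul_nonneg (hq.1 x) (InformationTheory.klFun_nonneg (div_nonneg (hp.1 x) (hq.1 x)))

theorem relEntropy_pos (hp : p ∈ stdSimplex ℝ X) (hq : q ∈ stdSimplex ℝ X)
    (hpq : support p ⊆ support q) (hne : p ≠ q) : 0 < relEntropy p q := by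
  refine (relEntropy_nonneg hp hq hpq).lt_of_ne' fun h0 => hne (funext fun x => ?_)
  have hdiv : ∀ x, 0 ≤ p x / q x := fun x => div_nonneg (hp.1 x) (hq.1 x)
  rw [relEntropy_eq_sum_klFun hpq (hp.2.trans hq.2.symm), Finset.sum_eq_zero_iff_of_nonneg
    fun x _ => mul_nonneg (hq.1 x) (InformationTheory.klFun_nonneg (hdiv x))] at h0
  rcases mul_eq_zero.1 (h0 x (Finset.mem_univ x)) with hqx | hkl
  · rw [hqx]
    exact by_contra fun hpx => hpq hpx hqx
  · exact eq_of_div_eq_one ((InformationTheory.klFun_eq_zero_iff (hdiv x)).1 hkl)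

theorem relEntropy_smul_right (hp : ∑ x, p x = 1) (hpw : support p ⊆ support w) {c : ℝ}
    (hc : c ≠ 0) : relEntropy p (c • w) = relEntropy p w - Real.log c := by
  have hterm : ∀ x, p x * Real.log (p x / (c • w) x) =
      p x * Real.log (p x / w x) - p x * Real.log c := by
    intro x
    by_cases hx : p x = 0
    · simp [hx]
    · rw [Pi.smul_apply, smul_eq_mul, mul_comm c, ← div_div,
        Real.log_div (div_ne_zero hx (hpw hx)) hc]
      ring
  simp only [relEntropy, hterm, Finset.sum_sub_distrib, ← Finset.sum_mul, hp, one_mul]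

theorem exp_neg_relEntropy_le_sum (hp : p ∈ stdSimplex ℝ X) (hw : 0 ≤ w)
    (hpw : support p ⊆ support w) : Real.exp (-relEntropy p w) ≤ ∑ x, w x := by
  have hZ : 0 < ∑ x, w x := by
    obtain ⟨a, -, ha⟩ := Finset.exists_ne_zero_of_sum_ne_zero (hp.2.symm ▸ one_ne_zero)
    exact Finset.sum_pos' (fun x _ => hw x) ⟨a, Finset.mem_univ a, (hw a).lt_of_ne' (hpw ha)⟩
  have hmem : (∑ x, w x)⁻¹ • w ∈ stdSimplex ℝ X := by
    refine ⟨fun x => mul_nonneg (inv_nonneg.2 hZ.le) (hw x), ?_⟩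
    simp only [Pi.smul_apply, smul_eq_mul, ← Finset.mul_sum, inv_mul_cancel₀ hZ.ne']
  have h := relEntropy_nonneg hp hmem
    (by rwa [Function.support_const_smul_of_ne_zero _ _ (inv_ne_zero hZ.ne')])
  rw [relEntropy_smul_right hp.2 hpw (inv_ne_zero hZ.ne'), Real.log_inv] at h
  rw [← Real.le_log_iff_exp_le hZ]
  linarith

theorem relEntropy_le_log (hp : p ∈ stdSimplex ℝ X) {c : ℝ} (hc : 0 < c)
    (h : ∀ x, p x ≤ c * q x) : relEntropy p q ≤ Real.log c := by
  calc relEntropy p q ≤ ∑ x, p x * Real.log c := by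
        refine Finset.sum_le_sum fun x _ => ?_
        rcases (hp.1 x).eq_or_lt with hx | hx
        · simp [← hx]
        · have hq : 0 < q x := pos_of_mul_pos_right (hx.trans_le (h x)) hc.le
          gcongr
          exact (div_le_iff₀ hq).2 (h x)
    _ = Real.log c := by rw [← Finset.sum_mul, hp.2, one_mul]

/-- The Chernoff coefficient `∑ q(x)^η p(x)^(1-η)`; minus the logarithm of its infimum over
`η ∈ [0, 1]` is the Chernoff information of `q` and `p`. -/
def chernoffCoeff (η : ℝ) (q p : X → ℝ) : ℝ := ∑ x, q x ^ η * p x ^ (1 - η)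

theorem chernoffCoeff_symm (η : ℝ) (p q : X → ℝ) :
    chernoffCoeff (1 - η) p q = chernoffCoeff η q p := by
  simp only [chernoffCoeff, sub_sub_cancel, mul_comm]

theorem chernoffCoeff_self (hp : p ∈ stdSimplex ℝ X) (η : ℝ) : chernoffCoeff η p p = 1 := by
  rw [← hp.2]
  refine Finset.sum_congr rfl fun x _ => ?_
  rw [← Real.rpow_add' (hp.1 x) (by simp), add_sub_cancel, Real.rpow_one]

theorem ne_of_chernoffCoeff_lt_one (hp : p ∈ stdSimplex ℝ X) {η : ℝ}
    (h : chernoffCoeff η q p < 1) : p ≠ q := by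
  rintro rfl
  exact h.ne (chernoffCoeff_self hp η)

theorem continuous_chernoffCoeff {η : ℝ} (hη : 0 ≤ η) (p : X → ℝ) :
    Continuous fun m : X → ℝ => chernoffCoeff η m p := by
  unfold chernoffCoeff
  fun_prop (disch := assumption)

-- Gibbs' inequality for the unnormalised geometric mixture `q ^ η * p ^ (1 - η)`.
theorem exp_neg_le_chernoffCoeff (hv : v ∈ stdSimplex ℝ X) (hq : 0 ≤ q) (hp : 0 ≤ p)
    (hvq : support v ⊆ support q) (hvp : support v ⊆ support p) (η : ℝ) :
    Real.exp (-(η * relEntropy v q + (1 - η) * relEntropy v p)) ≤ chernoffCoeff η q p := by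
  have hpos : ∀ x, v x ≠ 0 → 0 < q x ∧ 0 < p x := fun x hx =>
    ⟨(hq x).lt_of_ne' (hvq hx), (hp x).lt_of_ne' (hvp hx)⟩
  refine le_trans (le_of_eq ?_) (exp_neg_relEntropy_le_sum (w := fun x => q x ^ η * p x ^ (1 - η))
    hv (fun x => mul_nonneg (Real.rpow_nonneg (hq x) _) (Real.rpow_nonneg (hp x) _))
    fun x hx => ?_)
  · simp only [relEntropy, Finset.mul_sum, ← Finset.sum_add_distrib]
    congr 2
    refine Finset.sum_congr rfl fun x _ => ?_
    by_cases hx : v x = 0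
    · simp [hx]
    obtain ⟨hqx, hpx⟩ := hpos x hx
    rw [Real.log_div hx hqx.ne', Real.log_div hx hpx.ne', Real.log_div hx (by positivity),
      Real.log_mul (by positivity) (by positivity), Real.log_rpow hqx, Real.log_rpow hpx]
    ring
  · obtain ⟨hqx, hpx⟩ := hpos x hx
    exact (by positivity : 0 < q x ^ η * p x ^ (1 - η)).ne'

end RelEntropy

section Mix

variable {X : Type*} {p q m : X → ℝ} {α : ℝ}

/-- The mixture `(α p + q) / (1 + α)`, the minimiser of `m ↦ α D(p ‖ m) + D(q ‖ m)` in the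
definition of `GJS p q α`. -/
def mix (p q : X → ℝ) (α : ℝ) : X → ℝ := fun x => (α * p x + q x) / (1 + α)

theorem support_subset_mix_left (hp : 0 ≤ p) (hq : 0 ≤ q) (hα : 0 < α) :
    support p ⊆ support (mix p q α) := by
  intro x hx
  have hpx := (hp x).lt_of_ne' hx
  have hqx := hq x
  simp only [Pi.zero_apply] at hpx hqx
  exact (by unfold mix; positivity : 0 < mix p q α x).ne'

theorem support_subset_mix_right (hp : 0 ≤ p) (hq : 0 ≤ q) (hα : 0 ≤ α) :
    support q ⊆ support (mix p q α) := by
  intro x hx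
  have hqx := (hq x).lt_of_ne' hx
  have hpx := hp x
  simp only [Pi.zero_apply] at hpx hqx
  exact (by unfold mix; positivity : 0 < mix p q α x).ne'

theorem support_mix_subset (hpm : support p ⊆ support m) (hqm : support q ⊆ support m) :
    support (mix p q α) ⊆ support m := by
  intro x hx
  by_contra hmx
  have hpx : p x = 0 := by_contra fun h => hmx (hpm h)
  have hqx : q x = 0 := by_contra fun h => hmx (hqm h)
  exact hx (by simp [mix, hpx, hqx])

theorem tendsto_mix_nhdsGT_zero (p q : X → ℝ) : Tendsto (mix p q) (𝓝[>] 0) (𝓝 q) := by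
  have hcont : ContinuousAt (mix p q) 0 :=
    continuousAt_pi.2 fun x => ContinuousAt.div (by fun_prop) (by fun_prop) (by norm_num)
  have hzero : mix p q 0 = q := by
    funext x
    simp [mix]
  rw [ContinuousAt, hzero] at hcont
  exact hcont.mono_left nhdsWithin_le_nhds

end Mix

section GJS

variable {X : Type*} [Fintype X] {p q m : X → ℝ} {α γ : ℝ}

theorem GJS_eq_mix (p q : X → ℝ) (α : ℝ) :
    GJS p q α = α * relEntropy p (mix p q α) + relEntropy q (mix p q α) := rfl

theorem mix_mem_stdSimplex (hp : p ∈ stdSimplex ℝ X) (hq : q ∈ stdSimplex ℝ X) (hα : 0 ≤ α) :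
    mix p q α ∈ stdSimplex ℝ X := by
  constructor
  · intro x
    have := hp.1 x
    have := hq.1 x
    unfold mix
    positivity
  · simp only [mix, ← Finset.sum_div, Finset.sum_add_distrib, ← Finset.mul_sum, hp.2, hq.2]
    field_simp
    ring

theorem mul_log_div_add_mul_log_div {a b c : ℝ} (hb : a ≠ 0 → b ≠ 0) (hc : a ≠ 0 → c ≠ 0) :
    a * Real.log (a / b) + a * Real.log (b / c) = a * Real.log (a / c) := by
  by_cases ha : a = 0
  · simp [ha]
  · rw [Real.log_div ha (hb ha), Real.log_div (hb ha) (hc ha), Real.log_div ha (hc ha)]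
    ring

theorem GJS_add_relEntropy_mix (hp : 0 ≤ p) (hq : 0 ≤ q) (hα : 0 < α)
    (hpm : support p ⊆ support m) (hqm : support q ⊆ support m) :
    GJS p q α + (1 + α) * relEntropy (mix p q α) m =
      α * relEntropy p m + relEntropy q m := by
  simp only [GJS_eq_mix, relEntropy, Finset.mul_sum, ← Finset.sum_add_distrib]
  refine Finset.sum_congr rfl fun x _ => ?_
  have hmix : (1 + α) * mix p q α x = α * p x + q x := by
    unfold mix
    field_simp
  rw [← mul_log_div_add_mul_log_div (a := p x)
      (fun h => support_subset_mix_left hp hq hα h) fun h => hpm h,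
    ← mul_log_div_add_mul_log_div (a := q x)
      (fun h => support_subset_mix_right hp hq hα.le h) fun h => hqm h]
  linear_combination Real.log (mix p q α x / m x) * hmix

theorem GJS_le (hp : p ∈ stdSimplex ℝ X) (hq : q ∈ stdSimplex ℝ X) (hm : m ∈ stdSimplex ℝ X)
    (hα : 0 < α) (hpm : support p ⊆ support m) (hqm : support q ⊆ support m) :
    GJS p q α ≤ α * relEntropy p m + relEntropy q m := by
  rw [← GJS_add_relEntropy_mix hp.1 hq.1 hα hpm hqm, le_add_iff_nonneg_right]
  exact mul_nonneg (by positivity)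
    (relEntropy_nonneg (mix_mem_stdSimplex hp hq hα.le) hm (support_mix_subset hpm hqm))

theorem strictAntiOn_GJS_div (hp : p ∈ stdSimplex ℝ X) (hq : q ∈ stdSimplex ℝ X) (hne : p ≠ q) :
    StrictAntiOn (fun α => GJS p q α / α) (Set.Ioi 0) := by
  intro a (ha : 0 < a) b (hb : 0 < b) hab
  have hm := mix_mem_stdSimplex hp hq ha.le
  have hpm := support_subset_mix_left hp.1 hq.1 ha
  have hqm := support_subset_mix_right hp.1 hq.1 ha.le
  have hpos : 0 < relEntropy q (mix p q a) := by
    refine relEntropy_pos hq hm hqm fun h => hne (funext fun x => ?_)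
    have hx := congrFun h x
    rw [mix, eq_div_iff (by positivity)] at hx
    exact mul_left_cancel₀ ha.ne' (by linarith)
  calc GJS p q b / b
      ≤ (b * relEntropy p (mix p q a) + relEntropy q (mix p q a)) / b := by
        gcongr
        exact GJS_le hp hq hm hb hpm hqm
    _ = relEntropy p (mix p q a) + relEntropy q (mix p q a) / b := by field_simp
    _ < relEntropy p (mix p q a) + relEntropy q (mix p q a) / a := by gcongr
    _ = GJS p q a / a := by
      rw [GJS_eq_mix]
      field_simp

theorem GJS_eq_sum_negMulLog (hp : 0 ≤ p) (hq : 0 ≤ q) (hα : 0 < α) :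
    GJS p q α = ∑ x, ((1 + α) * Real.negMulLog (mix p q α x) - α * Real.negMulLog (p x) -
      Real.negMulLog (q x)) := by
  simp only [GJS_eq_mix, relEntropy, Finset.mul_sum, ← Finset.sum_add_distrib]
  refine Finset.sum_congr rfl fun x _ => ?_
  have hmix : (1 + α) * mix p q α x = α * p x + q x := by
    unfold mix
    field_simp
  have hlog : ∀ {a b : ℝ}, (a ≠ 0 → b ≠ 0) →
      a * Real.log (a / b) = a * Real.log a - a * Real.log b := by
    intro a b h
    by_cases ha : a = 0
    · simp [ha]
    · rw [Real.log_div ha (h ha), mul_sub]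
  rw [hlog fun h => support_subset_mix_left hp hq hα h,
    hlog fun h => support_subset_mix_right hp hq hα.le h]
  simp only [Real.negMulLog]
  linear_combination Real.log (mix p q α x) * hmix

theorem continuousOn_GJS :
    ContinuousOn (fun z : (X → ℝ) × (X → ℝ) × ℝ => GJS z.1 z.2.1 z.2.2)
      (Set.Ici 0 ×ˢ Set.Ici 0 ×ˢ Set.Ioi 0) := by
  refine ContinuousOn.congr ?_ fun z hz => GJS_eq_sum_negMulLog hz.1 hz.2.1 hz.2.2
  have hmix : ∀ x, ContinuousOn (fun z : (X → ℝ) × (X → ℝ) × ℝ => mix z.1 z.2.1 z.2.2 x)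
      (Set.Ici 0 ×ˢ Set.Ici 0 ×ˢ Set.Ioi 0) := fun x =>
    ContinuousOn.div (by fun_prop) (by fun_prop) fun z hz =>
      (add_pos one_pos (Set.mem_Ioi.1 hz.2.2)).ne'
  exact continuousOn_finsetSum _ fun x _ =>
    (((continuousOn_const.add (by fun_prop)).mul
      (Real.continuous_negMulLog.comp_continuousOn (hmix x))).sub
      ((by fun_prop : ContinuousOn _ _))).sub (by fun_prop)

theorem GJS_le_one_add_log (hp : p ∈ stdSimplex ℝ X) (hq : q ∈ stdSimplex ℝ X) (hα : 0 < α) :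
    GJS p q α ≤ 1 + Real.log (1 + α) := by
  have hDp : relEntropy p (mix p q α) ≤ Real.log ((1 + α) / α) := by
    refine relEntropy_le_log hp (by positivity) fun x => ?_
    have := hq.1 x
    unfold mix
    field_simp
    linarith
  have hDq : relEntropy q (mix p q α) ≤ Real.log (1 + α) := by
    refine relEntropy_le_log hq (by positivity) fun x => ?_
    have := mul_nonneg hα.le (hp.1 x)
    unfold mix
    field_simp
    linarith
  have hlog : α * Real.log ((1 + α) / α) ≤ 1 := by
    calc α * Real.log ((1 + α) / α) ≤ α * ((1 + α) / α - 1) := by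
          gcongr
          exact Real.log_le_sub_one_of_pos (by positivity)
      _ = 1 := by
        field_simp
        ring
  rw [GJS_eq_mix]
  nlinarith

theorem eventually_GJS_lt_mul (hp : p ∈ stdSimplex ℝ X) (hq : q ∈ stdSimplex ℝ X) (hγ : 0 < γ) :
    ∀ᶠ α in atTop, GJS p q α < γ * α := by
  filter_upwards [eventually_gt_atTop 0,
    eventually_gt_atTop (1 - 2 * Real.log (γ / 2) / γ)] with α hα hlarge
  have hlog := Real.log_le_sub_one_of_pos (show 0 < γ / 2 * (1 + α) by positivity)
  rw [Real.log_mul (by positivity) (by positivity)] at hlog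
  rw [sub_lt_comm, lt_div_iff₀ hγ] at hlarge
  linarith [GJS_le_one_add_log hp hq hα]

theorem eventually_mul_lt_GJS {η : ℝ} (hp : p ∈ stdSimplex ℝ X) (hq : q ∈ stdSimplex ℝ X)
    (hη : 0 < η) (hC : chernoffCoeff η q p < Real.exp (-(η * γ))) :
    ∀ᶠ α in 𝓝[>] (0 : ℝ), γ * α < GJS p q α := by
  have hmix := (((continuous_chernoffCoeff hη.le p).tendsto q).comp
    (tendsto_mix_nhdsGT_zero p q)).eventually_lt_const hC
  filter_upwards [hmix, self_mem_nhdsWithin] with α hCα (hα : 0 < α)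
  have hm := mix_mem_stdSimplex hp hq hα.le
  have hDp : γ < relEntropy p (mix p q α) := by
    have h := (exp_neg_le_chernoffCoeff hp hm.1 hp.1 (support_subset_mix_left hp.1 hq.1 hα)
      subset_rfl η).trans_lt hCα
    rw [Real.exp_lt_exp, relEntropy_self, mul_zero, add_zero, neg_lt_neg_iff] at h
    exact lt_of_mul_lt_mul_left h hη.le
  have hDq := relEntropy_nonneg hq hm (support_subset_mix_right hp.1 hq.1 hα.le)
  rw [GJS_eq_mix]
  nlinarith

theorem exists_GJS_eq_mul {η : ℝ} (hp : p ∈ stdSimplex ℝ X) (hq : q ∈ stdSimplex ℝ X)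
    (hη : 0 < η) (hγ : 0 < γ) (hC : chernoffCoeff η q p < Real.exp (-(η * γ))) :
    ∃ β, 0 < β ∧ GJS p q β = γ * β := by
  obtain ⟨a, ha, ha0 : 0 < a⟩ :=
    ((eventually_mul_lt_GJS hp hq hη hC).and self_mem_nhdsWithin).exists
  obtain ⟨b, hb, hab⟩ := ((eventually_GJS_lt_mul hp hq hγ).and (eventually_ge_atTop a)).exists
  have hcont : ContinuousOn (fun α => GJS p q α - γ * α) (Set.Icc a b) :=
    (continuousOn_GJS.comp (f := fun α => (p, q, α)) (by fun_prop)
      fun α hα => ⟨hp.1, hq.1, ha0.trans_le hα.1⟩).sub (by fun_prop)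
  obtain ⟨β, hβ, h⟩ := intermediate_value_Icc' hab hcont
    (show (0 : ℝ) ∈ Set.Icc _ _ from ⟨by linarith, by linarith⟩)
  exact ⟨β, ha0.trans_le hβ.1, sub_eq_zero.1 h⟩

theorem mul_lt_GJS_of_lt {a β : ℝ} (hp : p ∈ stdSimplex ℝ X) (hq : q ∈ stdSimplex ℝ X)
    (hne : p ≠ q) (ha : 0 < a) (haβ : a < β) (hβ : GJS p q β = γ * β) : γ * a < GJS p q a := by
  have hβ0 := ha.trans haβ
  have h : GJS p q β / β < GJS p q a / a := strictAntiOn_GJS_div hp hq hne ha hβ0 haβ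
  rwa [hβ, mul_div_cancel_right₀ _ hβ0.ne', lt_div_iff₀ ha] at h

theorem exists_isTheSolution {P Q : PMF X} {η : ℝ} (hη : 0 < η) (hγ : 0 < γ)
    (hC : chernoffCoeff η (pmfReal Q) (pmfReal P) < Real.exp (-(η * γ))) :
    ∃ β, IsTheSolution P Q γ β := by
  have hP := pmfReal_mem_stdSimplex P
  have hQ := pmfReal_mem_stdSimplex Q
  have hne : pmfReal P ≠ pmfReal Q := ne_of_chernoffCoeff_lt_one hP
    (hC.trans (by simpa using mul_pos hη hγ))
  obtain ⟨β, hβ, hsol⟩ := exists_GJS_eq_mul hP hQ hη hγ hC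
  refine ⟨β, hβ, hsol, fun a ha hasol => (strictAntiOn_GJS_div hP hQ hne).injOn ha hβ ?_⟩
  simp only [hsol, hasol, mul_div_cancel_right₀ _ ha.ne', mul_div_cancel_right₀ _ hβ.ne']

end GJS

section Chernoff

variable {X : Type*} [Fintype X] {p q : X → ℝ} {P Q : PMF X} {η γ : ℝ}

theorem continuousOn_chernoffCoeff_exponent (h : support p = support q) :
    ContinuousOn (fun η => chernoffCoeff η p q) (Set.Icc 0 1) := by
  refine continuousOn_finsetSum _ fun x _ => ?_
  by_cases hx : x ∈ support p
  · have hy := h ▸ hx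
    exact ((Real.continuous_const_rpow hx).mul
      ((Real.continuous_const_rpow hy).comp (by fun_prop))).continuousOn
  · have hy := h ▸ hx
    rw [Function.notMem_support] at hx hy
    refine (continuousOn_const (c := (0 : ℝ))).congr fun η _ => ?_
    rcases eq_or_ne η 0 with rfl | hη
    · simp [hy]
    · simp [hx, Real.zero_rpow hη]

theorem sum_rpow_eq_ofReal_chernoffCoeff (P Q : PMF X) (hη : η ∈ Set.Icc (0 : ℝ) 1) :
    ∑ x, P x ^ η * Q x ^ (1 - η) =
      ENNReal.ofReal (chernoffCoeff η (pmfReal P) (pmfReal Q)) := by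
  have hη' : 0 ≤ 1 - η := sub_nonneg.2 hη.2
  unfold chernoffCoeff pmfReal
  rw [ENNReal.ofReal_sum_of_nonneg fun x _ => by positivity]
  refine Finset.sum_congr rfl fun x _ => ?_
  rw [ENNReal.ofReal_mul (by positivity), ENNReal.toReal_rpow, ENNReal.toReal_rpow,
    ENNReal.ofReal_toReal (ENNReal.rpow_ne_top_of_nonneg hη.1 (P.apply_ne_top x)),
    ENNReal.ofReal_toReal (ENNReal.rpow_ne_top_of_nonneg hη' (Q.apply_ne_top x))]

theorem log_sum_rpow_le_iff (hη : η ∈ Set.Icc (0 : ℝ) 1) :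
    ENNReal.log (∑ x, P x ^ η * Q x ^ (1 - η)) ≤ -(γ : EReal) ↔
      chernoffCoeff η (pmfReal P) (pmfReal Q) ≤ Real.exp (-γ) := by
  rw [sum_rpow_eq_ofReal_chernoffCoeff P Q hη, ← EReal.coe_neg, ← EReal.log_exp (-γ : ℝ),
    ENNReal.log_le_log_iff, EReal.exp_coe, ENNReal.ofReal_le_ofReal_iff (Real.exp_pos _).le]

theorem exists_chernoffCoeff_le_of_lt_chernoff (hγ : (γ : EReal) < chernoff P Q) :
    ∃ η ∈ Set.Icc (0 : ℝ) 1, chernoffCoeff η (pmfReal P) (pmfReal Q) ≤ Real.exp (-γ) := by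
  obtain ⟨η, hη, h⟩ : ∃ η ∈ Set.Icc (0 : ℝ) 1,
      ENNReal.log (∑ x, P x ^ η * Q x ^ (1 - η)) < -(γ : EReal) := by
    rw [chernoff, EReal.lt_neg_comm] at hγ
    simpa only [iInf_lt_iff, exists_prop] using hγ
  exact ⟨η, hη, (log_sum_rpow_le_iff hη).1 h.le⟩

theorem exists_chernoffCoeff_le_of_support_eq (hsupp : P.support = Q.support)
    (hγ : (γ : EReal) ≤ chernoff P Q) :
    ∃ η ∈ Set.Icc (0 : ℝ) 1, chernoffCoeff η (pmfReal P) (pmfReal Q) ≤ Real.exp (-γ) := by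
  have hsupport : ∀ R : PMF X, support (pmfReal R) = R.support := fun R => by
    ext x
    simp [pmfReal, ENNReal.toReal_eq_zero_iff, R.apply_ne_top, PMF.mem_support_iff]
  obtain ⟨η, hη, hmin⟩ := isCompact_Icc.exists_isMinOn (Set.nonempty_Icc.2 zero_le_one)
    (continuousOn_chernoffCoeff_exponent
      ((hsupport P).trans (hsupp.trans (hsupport Q).symm)))
  refine ⟨η, hη, (log_sum_rpow_le_iff hη).1 (le_trans ?_ (EReal.le_neg_of_le_neg hγ))⟩
  refine le_iInf₂ fun ζ hζ => ENNReal.log_le_log ?_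
  rw [sum_rpow_eq_ofReal_chernoffCoeff P Q hη, sum_rpow_eq_ofReal_chernoffCoeff P Q hζ]
  exact ENNReal.ofReal_le_ofReal (hmin hζ)

theorem exists_chernoffCoeff_le (hγ : 0 < γ) (hγC : (γ : EReal) ≤ chernoff P Q)
    (hsupp : (γ : EReal) = chernoff P Q → P.support = Q.support) :
    ∃ η ∈ Set.Ioo (0 : ℝ) 1, chernoffCoeff η (pmfReal P) (pmfReal Q) ≤ Real.exp (-γ) := by
  obtain ⟨η, hη, hC⟩ : ∃ η ∈ Set.Icc (0 : ℝ) 1,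
      chernoffCoeff η (pmfReal P) (pmfReal Q) ≤ Real.exp (-γ) := by
    rcases hγC.lt_or_eq with hlt | heq
    · exact exists_chernoffCoeff_le_of_lt_chernoff hlt
    · exact exists_chernoffCoeff_le_of_support_eq (hsupp heq) heq.le
  have hne : chernoffCoeff η (pmfReal P) (pmfReal Q) ≠ 1 :=
    (hC.trans_lt (by simpa using hγ)).ne
  refine ⟨η, ⟨hη.1.lt_of_ne ?_, hη.2.lt_of_ne ?_⟩, hC⟩
  · rintro rfl
    simp [chernoffCoeff, (pmfReal_mem_stdSimplex Q).2] at hne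
  · rintro rfl
    simp [chernoffCoeff, (pmfReal_mem_stdSimplex P).2] at hne

end Chernoff

section Types

variable {X : Type*} {n N : ℕ}

theorem support_empirical (x : Fin n → X) : support (empirical x) = Set.range x := by
  classical
  ext a
  rw [Function.mem_support, empirical, Finset.sum_boole, mul_ne_zero_iff, Nat.cast_ne_zero,
    Finset.card_ne_zero]
  constructor
  · rintro ⟨-, i, hi⟩
    exact ⟨i, (Finset.mem_filter.1 hi).2⟩
  · rintro ⟨i, rfl⟩
    exact ⟨one_div_ne_zero (Nat.cast_ne_zero.2 i.pos.ne'), i, by simp⟩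

theorem empirical_nonneg (x : Fin n → X) : 0 ≤ empirical x := fun _ =>
  mul_nonneg (by positivity) (Finset.sum_nonneg fun _ _ => by split_ifs <;> norm_num)

theorem prod_empirical_nonneg (x : Fin n → X) : 0 ≤ ∏ i, empirical x (x i) :=
  Finset.prod_nonneg fun _ _ => empirical_nonneg x _

theorem prod_apply_word_eq_zero {x : Fin n → X} {q : X → ℝ}
    (hsupp : ¬ support (empirical x) ⊆ support q) : ∏ i, q (x i) = 0 := by
  rw [support_empirical, Set.range_subset_iff, not_forall] at hsupp
  obtain ⟨i, hi⟩ := hsupp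
  exact Finset.prod_eq_zero (Finset.mem_univ i) (by simpa using hi)

variable [Fintype X]

theorem sum_apply_word (x : Fin n → X) (f : X → ℝ) :
    ∑ i, f (x i) = n * ∑ a, empirical x a * f a := by
  classical
  rcases n.eq_zero_or_pos with rfl | hn
  · simp
  simp only [empirical, mul_assoc, Finset.sum_mul, ite_mul, one_mul, zero_mul, ← Finset.mul_sum]
  rw [Finset.sum_comm, ← mul_assoc, mul_one_div_cancel (by positivity), one_mul]
  simp only [Finset.sum_ite_eq, Finset.mem_univ, if_true]

theorem empirical_mem_stdSimplex (hn : 0 < n) (x : Fin n → X) :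
    empirical x ∈ stdSimplex ℝ X := by
  refine ⟨empirical_nonneg x, ?_⟩
  have h := sum_apply_word x fun _ => 1
  simp only [Finset.sum_const, Finset.card_univ, Fintype.card_fin, nsmul_eq_mul, mul_one] at h
  exact (mul_eq_left₀ (by positivity)).1 h.symm

theorem prod_apply_word (x : Fin n → X) {q : X → ℝ} (hq : 0 ≤ q)
    (hsupp : support (empirical x) ⊆ support q) :
    ∏ i, q (x i) =
      (∏ i, empirical x (x i)) * Real.exp (-(n * relEntropy (empirical x) q)) := by
  have hx : ∀ i, x i ∈ support (empirical x) := fun i => by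
    rw [support_empirical]
    exact Set.mem_range_self i
  have hn : ∀ i, 0 < empirical x (x i) := fun i =>
    (empirical_nonneg x _).lt_of_ne' (hx i)
  have hqx : ∀ i, 0 < q (x i) := fun i => (hq _).lt_of_ne' (hsupp (hx i))
  rw [relEntropy, ← sum_apply_word x fun a => Real.log (empirical x a / q a),
    ← Finset.sum_neg_distrib, Real.exp_sum, ← Finset.prod_mul_distrib]
  refine Finset.prod_congr rfl fun i _ => ?_
  rw [Real.exp_neg, Real.exp_log (div_pos (hn i) (hqx i)), inv_div, mul_div_cancel₀ _ (hn i).ne']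

variable (X) in
open scoped Classical in
theorem card_image_empirical_le (n : ℕ) :
    (Finset.univ.image (empirical : (Fin n → X) → X → ℝ)).card ≤ (n + 1) ^ Fintype.card X := by
  let ofCounts : (X → Fin (n + 1)) → X → ℝ := fun c a => 1 / (n : ℝ) * (c a : ℕ)
  calc _ ≤ (Finset.univ.image ofCounts).card := by
        refine Finset.card_le_card (Finset.image_subset_iff.2 fun x _ => Finset.mem_image.2
          ⟨fun a => ⟨({i | x i = a} : Finset (Fin n)).card, Nat.lt_succ_of_le ?_⟩,
            Finset.mem_univ _, ?_⟩)
        · exact (Finset.card_le_univ _).trans_eq (Fintype.card_fin n)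
        · funext a
          simp only [ofCounts, empirical, Finset.sum_boole]
    _ ≤ Fintype.card (X → Fin (n + 1)) := Finset.card_image_le
    _ = (n + 1) ^ Fintype.card X := by rw [Fintype.card_fun, Fintype.card_fin]

-- Each type `t` occurring in the sum is the i.i.d. law of some words, of total mass at most one.
theorem sum_prod_empirical_le (hn : 0 < n) :
    ∑ x : Fin n → X, ∏ i, empirical x (x i) ≤ ((n : ℝ) + 1) ^ Fintype.card X := by
  classical
  let types := Finset.univ.image (empirical : (Fin n → X) → X → ℝ)
  have htypes : ∀ t ∈ types, t ∈ stdSimplex ℝ X := by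
    simp only [types, Finset.mem_image, Finset.mem_univ, true_and, forall_exists_index,
      forall_apply_eq_imp_iff]
    exact empirical_mem_stdSimplex hn
  calc ∑ x : Fin n → X, ∏ i, empirical x (x i)
      ≤ ∑ x : Fin n → X, ∑ t ∈ types, ∏ i, t (x i) :=
        Finset.sum_le_sum fun x _ => Finset.single_le_sum (f := fun t => ∏ i, t (x i))
          (fun t ht => Finset.prod_nonneg fun i _ => (htypes t ht).1 _)
          (Finset.mem_image_of_mem _ (Finset.mem_univ x))
    _ = ∑ t ∈ types, ∑ x : Fin n → X, ∏ i, t (x i) := Finset.sum_comm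
    _ = types.card := by
        rw [Finset.card_eq_sum_ones, Nat.cast_sum]
        refine Finset.sum_congr rfl fun t ht => ?_
        rw [← Fintype.sum_pow, (htypes t ht).2, one_pow, Nat.cast_one]
    _ ≤ ((n : ℝ) + 1) ^ Fintype.card X := by exact_mod_cast card_image_empirical_le X n

theorem score_le_relEntropy_add (hN : 0 < N) (hn : 0 < n) (x : Fin N → X) (y : Fin n → X)
    {q : X → ℝ} (hq : q ∈ stdSimplex ℝ X) (hx : support (empirical x) ⊆ support q)
    (hy : support (empirical y) ⊆ support q) :
    score x y ≤ N * relEntropy (empirical x) q + n * relEntropy (empirical y) q := by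
  calc score x y ≤ n * (N / n * relEntropy (empirical x) q + relEntropy (empirical y) q) := by
        unfold score
        gcongr
        exact GJS_le (empirical_mem_stdSimplex hN x) (empirical_mem_stdSimplex hn y) hq
          (by positivity) hx hy
    _ = _ := by field_simp

end Types

theorem measureReal_le_sum {Ω : Type*} [Fintype Ω] [MeasurableSpace Ω]
    [MeasurableSingletonClass Ω] (μ : Measure Ω) [SigmaFinite μ] {s : Set Ω} {b : Ω → ℝ}
    (hb : 0 ≤ b) (h : ∀ ω ∈ s, μ.real {ω} ≤ b ω) : μ.real s ≤ ∑ ω, b ω := by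
  classical
  calc μ.real s = ∑ ω with ω ∈ s, μ.real {ω} := by simp
    _ ≤ ∑ ω with ω ∈ s, b ω := Finset.sum_le_sum fun ω hω => h ω (Finset.mem_filter.1 hω).2
    _ ≤ ∑ ω, b ω := Finset.sum_le_univ_sum_of_nonneg hb

section WordLaw

variable {X : Type*} [MeasurableSpace X] {n N : ℕ}

/-- The law of an i.i.d. word of length `n` with letters drawn from `P`. -/
def wordLaw (P : PMF X) (n : ℕ) : Measure (Fin n → X) := Measure.pi fun _ : Fin n => P.toMeasure

instance isProbabilityMeasure_wordLaw (P : PMF X) (n : ℕ) : IsProbabilityMeasure (wordLaw P n) := by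
  unfold wordLaw
  infer_instance

variable [MeasurableSingletonClass X]

theorem wordLaw_real_singleton (P : PMF X) (x : Fin n → X) :
    (wordLaw P n).real {x} = ∏ i, pmfReal P (x i) := by
  simp only [wordLaw, Measure.real, Measure.pi_singleton, ENNReal.toReal_prod, pmfReal,
    P.toMeasure_apply_singleton _ (measurableSet_singleton _)]

variable [Fintype X]

-- The upper bound in Sanov's theorem. Words leaving the support of `P` have probability zero, so
-- they may be included although `relEntropy` is a junk value there.
theorem wordLaw_le_relEntropy_le (P : PMF X) (hn : 0 < n) (c : ℝ) :
    (wordLaw P n).real {x | support (empirical x) ⊆ support (pmfReal P) →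
        c ≤ relEntropy (empirical x) (pmfReal P)} ≤
      ((n : ℝ) + 1) ^ Fintype.card X * Real.exp (-(n * c)) := by
  have hb : ∀ x : Fin n → X, 0 ≤ (∏ i, empirical x (x i)) * Real.exp (-(n * c)) := fun x =>
    mul_nonneg (prod_empirical_nonneg x) (Real.exp_pos _).le
  calc _ ≤ ∑ x : Fin n → X, (∏ i, empirical x (x i)) * Real.exp (-(n * c)) := by
        refine measureReal_le_sum _ hb fun x hx => ?_
        rw [wordLaw_real_singleton]
        by_cases hsupp : support (empirical x) ⊆ support (pmfReal P)
        · rw [prod_apply_word x (pmfReal_mem_stdSimplex P).1 hsupp]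
          gcongr
          · exact prod_empirical_nonneg x
          · exact hx hsupp
        · rw [prod_apply_word_eq_zero hsupp]
          exact hb x
    _ ≤ _ := by
        rw [← Finset.sum_mul]
        gcongr
        exact sum_prod_empirical_le hn

theorem wordLaw_prod_real_singleton_le (P : PMF X) (hN : 0 < N) (hn : 0 < n) (x : Fin N → X)
    (y : Fin n → X) :
    ((wordLaw P N).prod (wordLaw P n)).real {(x, y)} ≤
      (∏ i, empirical x (x i)) * (∏ i, empirical y (y i)) * Real.exp (-score x y) := by
  have hP := pmfReal_mem_stdSimplex P
  have hprod := mul_nonneg (prod_empirical_nonneg x) (prod_empirical_nonneg y)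
  rw [← Set.singleton_prod_singleton, measureReal_prod_prod, wordLaw_real_singleton,
    wordLaw_real_singleton]
  by_cases hx : support (empirical x) ⊆ support (pmfReal P)
  · by_cases hy : support (empirical y) ⊆ support (pmfReal P)
    · rw [prod_apply_word x hP.1 hx, prod_apply_word y hP.1 hy, mul_mul_mul_comm, ← Real.exp_add]
      gcongr
      linarith [score_le_relEntropy_add hN hn x y hP hx hy]
    · rw [prod_apply_word_eq_zero hy, mul_zero]
      positivity
  · rw [prod_apply_word_eq_zero hx, zero_mul]
    positivity

theorem wordLaw_prod_le_score_le (P : PMF X) (hN : 0 < N) (hn : 0 < n) (s : ℝ) :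
    ((wordLaw P N).prod (wordLaw P n)).real {z | s ≤ score z.1 z.2} ≤
      ((N : ℝ) + 1) ^ Fintype.card X * ((n : ℝ) + 1) ^ Fintype.card X * Real.exp (-s) := by
  have hprod : ∀ (x : Fin N → X) (y : Fin n → X),
      0 ≤ (∏ i, empirical x (x i)) * ∏ i, empirical y (y i) := fun x y =>
    mul_nonneg (prod_empirical_nonneg x) (prod_empirical_nonneg y)
  calc _ ≤ ∑ z : (Fin N → X) × (Fin n → X),
        (∏ i, empirical z.1 (z.1 i)) * (∏ i, empirical z.2 (z.2 i)) * Real.exp (-s) := by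
        refine measureReal_le_sum _ (fun z => mul_nonneg (hprod _ _) (Real.exp_pos _).le)
          fun z hz => (wordLaw_prod_real_singleton_le P hN hn z.1 z.2).trans ?_
        gcongr
        · exact hprod _ _
        · exact hz
    _ = (∑ x : Fin N → X, ∏ i, empirical x (x i)) * (∑ y : Fin n → X, ∏ i, empirical y (y i)) *
          Real.exp (-s) := by
        rw [← Finset.sum_mul, Fintype.sum_mul_sum, Fintype.sum_prod_type]
    _ ≤ _ := by
        gcongr
        · exact Finset.sum_nonneg fun y _ => prod_empirical_nonneg y
        · exact sum_prod_empirical_le hN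
        · exact sum_prod_empirical_le hn

theorem wordLaw_le_sum_sub_mul_le (P : PMF X) (n : ℕ) {f : X → ℝ} {c : ℝ}
    (hf : ∀ a, f a ∈ Set.Icc c (c + 1)) {ε : ℝ} (hε : 0 ≤ ε) :
    (wordLaw P n).real {x | ε ≤ ∑ a, (empirical x a - pmfReal P a) * f a} ≤
      Real.exp (-(2 * ε ^ 2 * n)) := by
  let centred : X → ℝ := fun a => f a - ∫ b, f b ∂P.toMeasure
  have hindep : ProbabilityTheory.iIndepFun (fun i (x : Fin n → X) => centred (x i))
      (wordLaw P n) := ProbabilityTheory.iIndepFun_pi fun _ => (measurable_of_finite _).aemeasurable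
  have hsub : ∀ i ∈ (Finset.univ : Finset (Fin n)),
      ProbabilityTheory.HasSubgaussianMGF (fun x : Fin n → X => centred (x i))
        ((‖c + 1 - c‖₊ / 2) ^ 2) (wordLaw P n) := fun i _ => by
    refine ProbabilityTheory.HasSubgaussianMGF.of_map (X := centred)
      (Y := fun x : Fin n → X => x i) (measurable_pi_apply i).aemeasurable ?_
    rw [wordLaw, (measurePreserving_eval (fun _ : Fin n => P.toMeasure) i).map_eq]
    exact ProbabilityTheory.hasSubgaussianMGF_of_mem_Icc (measurable_of_finite f).aemeasurable
      (ae_of_all _ hf)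
  have hsum : ∀ x : Fin n → X,
      ∑ i, centred (x i) = n * ∑ a, (empirical x a - pmfReal P a) * f a := by
    intro x
    simp only [centred, Finset.sum_sub_distrib, sum_apply_word, PMF.integral_eq_sum, sub_mul,
      mul_sub, smul_eq_mul, Finset.sum_const, Finset.card_univ, Fintype.card_fin, nsmul_eq_mul,
      pmfReal]
  calc _ ≤ (wordLaw P n).real {x | n * ε ≤ ∑ i, centred (x i)} := by
        refine measureReal_mono fun x hx => ?_
        rw [Set.mem_ofPred_eq, hsum]
        exact mul_le_mul_of_nonneg_left hx (by positivity)
    _ ≤ _ := ProbabilityTheory.HasSubgaussianMGF.measure_sum_ge_le_of_iIndepFun hindep hsub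
        (by positivity)
    _ = Real.exp (-(2 * ε ^ 2 * n)) := by
        rcases n.eq_zero_or_pos with rfl | hn
        · simp
        congr 1
        simp only [add_sub_cancel_left, nnnorm_one, one_div, inv_pow, Finset.sum_const,
          Finset.card_univ, Fintype.card_fin, nsmul_eq_mul, NNReal.coe_mul, NNReal.coe_natCast,
          NNReal.coe_inv, NNReal.coe_pow, NNReal.coe_ofNat]
        field_simp

theorem wordLaw_le_dist_empirical_le (P : PMF X) (n : ℕ) {ε : ℝ} (hε : 0 < ε) :
    (wordLaw P n).real {x | ε ≤ dist (empirical x) (pmfReal P)} ≤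
      2 * Fintype.card X * Real.exp (-(2 * ε ^ 2 * n)) := by
  classical
  let deviation : X → (Fin n → X) → ℝ := fun a x => empirical x a - pmfReal P a
  have hupper : ∀ a, (wordLaw P n).real {x | ε ≤ deviation a x} ≤ Real.exp (-(2 * ε ^ 2 * n)) :=
    fun a => by
      simpa [Pi.single_apply] using wordLaw_le_sum_sub_mul_le P n (f := Pi.single a 1) (c := 0)
        (fun b => by by_cases h : b = a <;> simp [h]) hε.le
  have hlower : ∀ a, (wordLaw P n).real {x | ε ≤ -deviation a x} ≤ Real.exp (-(2 * ε ^ 2 * n)) :=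
    fun a => by
      simpa [deviation, Pi.single_apply] using
        wordLaw_le_sum_sub_mul_le P n (f := Pi.single a (-1)) (c := -1)
          (fun b => by by_cases h : b = a <;> simp [h]) hε.le
  have hcover : {x : Fin n → X | ε ≤ dist (empirical x) (pmfReal P)} ⊆
      ⋃ a, ({x | ε ≤ deviation a x} ∪ {x | ε ≤ -deviation a x}) := by
    intro x hx
    by_contra hcon
    simp only [Set.mem_iUnion, Set.mem_union, Set.mem_ofPred_eq, not_exists, ← le_abs,
      not_le] at hcon
    exact not_lt.2 hx ((dist_pi_lt_iff hε).2 hcon)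
  calc _ ≤ ∑ a, ((wordLaw P n).real {x | ε ≤ deviation a x} +
        (wordLaw P n).real {x | ε ≤ -deviation a x}) :=
        (measureReal_mono hcover).trans ((measureReal_iUnion_fintype_le _).trans
          (Finset.sum_le_sum fun a _ => measureReal_union_le _ _))
    _ ≤ ∑ _ : X, 2 * Real.exp (-(2 * ε ^ 2 * n)) :=
        Finset.sum_le_sum fun a _ => by linarith [hupper a, hlower a]
    _ = 2 * Fintype.card X * Real.exp (-(2 * ε ^ 2 * n)) := by
        rw [Finset.sum_const, Finset.card_univ, nsmul_eq_mul]
        ring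

end WordLaw

section Growth

variable {u : ℕ → ℝ≥0∞}

theorem expGrowthSup_natCast_add_one_pow (m : ℕ) :
    expGrowthSup (fun N => ((N : ℝ≥0∞) + 1) ^ m) = 0 := by
  refine le_antisymm (EReal.le_of_forall_lt_iff_le.1 fun b hb => ?_) ?_
  · have hlim : Tendsto (fun N : ℕ => (N : ℝ) + 1) atTop atTop :=
      tendsto_atTop_add_const_right _ _ tendsto_natCast_atTop_atTop
    have hle : ∀ᶠ N : ℕ in atTop,
        ((N : ℝ≥0∞) + 1) ^ m ≤ ENNReal.ofReal (Real.exp b) * EReal.exp ((b : EReal) * N) := by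
      filter_upwards [((isLittleO_pow_exp_pos_mul_atTop m (EReal.coe_pos.1 hb)).comp_tendsto
        hlim).bound one_pos] with N hN
      simp only [Function.comp_apply, Real.norm_eq_abs, Real.abs_exp, one_mul] at hN
      calc ((N : ℝ≥0∞) + 1) ^ m = ENNReal.ofReal (((N : ℝ) + 1) ^ m) := by
            rw [ENNReal.ofReal_pow (by positivity), ENNReal.ofReal_add (by positivity) one_pos.le,
              ENNReal.ofReal_natCast, ENNReal.ofReal_one]
        _ ≤ ENNReal.ofReal (Real.exp b * Real.exp (b * N)) := by
            refine ENNReal.ofReal_le_ofReal ((le_abs_self _).trans (hN.trans_eq ?_))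
            rw [← Real.exp_add]
            ring_nf
        _ = ENNReal.ofReal (Real.exp b) * EReal.exp ((b : EReal) * N) := by
            rw [ENNReal.ofReal_mul (Real.exp_pos _).le, ← EReal.exp_coe (b * N), EReal.coe_mul,
              EReal.coe_natCast]
    exact (expGrowthSup_le_of_eventually_le ENNReal.ofReal_ne_top hle).trans_eq expGrowthSup_exp
  · rw [← expGrowthSup_const one_ne_zero ENNReal.one_ne_top]
    exact expGrowthSup_monotone fun N => one_le_pow₀ le_add_self

theorem expGrowthSup_natCast_add_one_pow_mul_le (m : ℕ) (u : ℕ → ℝ≥0∞) :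
    expGrowthSup (fun N => ((N : ℝ≥0∞) + 1) ^ m * u N) ≤ expGrowthSup u := by
  have hpow := expGrowthSup_natCast_add_one_pow m
  refine (expGrowthSup_mul_le (Or.inl ?_) (Or.inl ?_)).trans_eq ?_ <;> rw [hpow]
  · exact EReal.zero_ne_bot
  · exact EReal.zero_ne_top
  · exact zero_add _

theorem expGrowthSup_le_of_eventually_le_pow_mul_exp {C c : ℝ} {m : ℕ} (hC : 0 ≤ C)
    (h : ∀ᶠ N : ℕ in atTop,
      u N ≤ ENNReal.ofReal (C * ((N : ℝ) + 1) ^ m * Real.exp (-(c * N)))) :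
    expGrowthSup u ≤ ((-c : ℝ) : EReal) := by
  have hle : ∀ᶠ N : ℕ in atTop, u N ≤ ENNReal.ofReal C *
      (((N : ℝ≥0∞) + 1) ^ m * EReal.exp (((-c : ℝ) : EReal) * N)) := by
    filter_upwards [h] with N hN
    refine hN.trans_eq ?_
    rw [mul_assoc, ENNReal.ofReal_mul hC, ENNReal.ofReal_mul (by positivity),
      ENNReal.ofReal_pow (by positivity), ENNReal.ofReal_add (by positivity) one_pos.le,
      ENNReal.ofReal_natCast, ENNReal.ofReal_one, ← EReal.coe_natCast, ← EReal.coe_mul,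
      EReal.exp_coe, neg_mul]
  exact ((expGrowthSup_le_of_eventually_le ENNReal.ofReal_ne_top hle).trans
    (expGrowthSup_natCast_add_one_pow_mul_le m _)).trans_eq expGrowthSup_exp

theorem tendsto_zero_of_expGrowthSup_neg (h : expGrowthSup u < 0) : Tendsto u atTop (𝓝 0) := by
  obtain ⟨a, hua, ha⟩ := EReal.lt_iff_exists_real_btwn.1 h
  have ha' : EReal.exp a < 1 := EReal.exp_lt_one_iff.2 ha
  refine tendsto_of_tendsto_of_tendsto_of_le_of_le' tendsto_const_nhds
    (ENNReal.tendsto_pow_atTop_nhds_zero_of_lt_one ha') (Eventually.of_forall fun _ => zero_le) ?_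
  filter_upwards [eventually_le_exp hua] with N hN
  rwa [mul_comm, EReal.exp_nmul] at hN

theorem linearGrowthSup_le_of_le_ceil_add {ET : ℕ → ℝ≥0∞} {t : ℝ} (ht : 0 ≤ t)
    (hu : expGrowthSup u < 0) (h : ∀ᶠ N : ℕ in atTop, ET N ≤ ⌈t * N⌉₊ + (N : ℝ≥0∞) ^ 2 * u N) :
    linearGrowthSup (fun N => (ET N : EReal)) ≤ (t : EReal) := by
  have hsmall := tendsto_zero_of_expGrowthSup_neg
    ((expGrowthSup_natCast_add_one_pow_mul_le 2 u).trans_lt hu)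
  refine EReal.le_of_forall_lt_iff_le.1 fun b hb => Eventually.linearGrowthSup_le ?_
  have htb : 0 < b - t := sub_pos.2 (EReal.coe_lt_coe_iff.1 hb)
  filter_upwards [h, hsmall.eventually_le_const one_pos,
    tendsto_natCast_atTop_atTop.eventually_ge_atTop (2 / (b - t))] with N hN hN1 hNb
  rw [div_le_iff₀' htb] at hNb
  have hET : ET N ≤ ENNReal.ofReal (b * N) := by
    calc ET N ≤ ⌈t * N⌉₊ + ((N : ℝ≥0∞) + 1) ^ 2 * u N := hN.trans (by gcongr; exact le_self_add)
      _ ≤ ⌈t * N⌉₊ + 1 := by gcongr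
      _ = ENNReal.ofReal (⌈t * N⌉₊ + 1) := by
          rw [ENNReal.ofReal_add (by positivity) one_pos.le, ENNReal.ofReal_natCast,
            ENNReal.ofReal_one]
      _ ≤ ENNReal.ofReal (b * N) := ENNReal.ofReal_le_ofReal (by
          linarith [Nat.ceil_lt_add_one (show 0 ≤ t * N by positivity)])
  have hbN : 0 ≤ b * N := mul_nonneg (by linarith) N.cast_nonneg
  calc (ET N : EReal) ≤ (ENNReal.ofReal (b * N) : EReal) :=
        EReal.coe_ennreal_le_coe_ennreal_iff.2 hET
    _ = (b : EReal) * N := by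
        rw [EReal.coe_ennreal_ofReal, max_eq_left hbN, EReal.coe_mul, EReal.coe_natCast]

theorem le_liminf_neg_log_div {Err ET : ℕ → ℝ≥0∞} {γ τ : ℝ} (hγ : 0 < γ) (hτ : 0 < τ)
    (hErr : expGrowthSup Err ≤ ((-γ : ℝ) : EReal))
    (hET : linearGrowthSup (fun N => (ET N : EReal)) ≤ (τ : EReal))
    (hET0 : ∀ᶠ N in atTop, 0 < ET N) :
    ((γ / τ : ℝ) : EReal) ≤ liminf (fun N => -ENNReal.log (Err N) / (ET N : EReal)) atTop := by
  refine EReal.ge_of_forall_gt_iff_ge.1 fun c hc => ?_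
  obtain ⟨b, hcb, hb⟩ := exists_between (max_lt (EReal.coe_lt_coe_iff.1 hc) (div_pos hγ hτ))
  obtain ⟨hcb, hb0⟩ := max_lt_iff.1 hcb
  obtain ⟨t, hτt, htb⟩ := exists_between ((lt_div_iff₀' hb0).2 ((lt_div_iff₀ hτ).1 hb))
  have hbt : b * t < γ := (lt_div_iff₀' hb0).1 htb
  refine le_liminf_of_le (by isBoundedDefault) ?_
  filter_upwards [hET0, eventually_le_mul (hET.trans_lt (EReal.coe_lt_coe_iff.2 hτt)),
    eventually_le_exp (hErr.trans_lt (EReal.coe_lt_coe_iff.2 (neg_lt_neg hbt)))]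
    with N hpos htime herr
  have htop : (ET N : EReal) ≠ ⊤ := by
    refine (htime.trans_lt ?_).ne
    rw [← EReal.coe_natCast, ← EReal.coe_mul]
    exact EReal.coe_lt_top _
  have hlog : ENNReal.log (Err N) ≤ ((-(b * t) : ℝ) : EReal) * N := by
    rwa [← EReal.exp_le_exp_iff, ENNReal.exp_log]
  refine (EReal.coe_le_coe_iff.2 hcb.le).trans
    ((EReal.le_div_iff_mul_le (EReal.coe_ennreal_pos.2 hpos) htop).2 ?_)
  calc (b : EReal) * ET N ≤ b * (t * N) :=
        mul_le_mul_of_nonneg_left htime (EReal.coe_nonneg.2 hb0.le)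
    _ = -(((-(b * t) : ℝ) : EReal) * N) := by
        rw [← EReal.neg_mul, EReal.coe_neg, neg_neg, EReal.coe_mul, mul_assoc]
    _ ≤ -ENNReal.log (Err N) := EReal.neg_le_neg_iff.2 hlog

end Growth

theorem dist_mix_le {X : Type*} [Fintype X] {p q : X → ℝ} (hp : p ∈ stdSimplex ℝ X)
    (hq : q ∈ stdSimplex ℝ X) {α : ℝ} (hα : 0 ≤ α) : dist (mix p q α) q ≤ α := by
  refine (dist_pi_le_iff hα).2 fun x => ?_
  have hmix : mix p q α x - q x = α / (1 + α) * (p x - q x) := by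
    unfold mix
    field_simp
    ring
  have hpq : |p x - q x| ≤ 1 := by
    have hp1 := hp.1 x
    have hq1 := hq.1 x
    have hp2 := (mem_Icc_of_mem_stdSimplex hp x).2
    have hq2 := (mem_Icc_of_mem_stdSimplex hq x).2
    exact abs_le.2 ⟨by linarith, by linarith⟩
  rw [Real.dist_eq, hmix, abs_mul, abs_of_nonneg (by positivity)]
  calc α / (1 + α) * |p x - q x| ≤ α / (1 + α) * 1 := by gcongr
    _ ≤ α := by
      rw [mul_one]
      exact div_le_self hα (by linarith)

theorem lt_relEntropy_of_GJS_lt {X : Type*} [Fintype X] {t y p : X → ℝ} {η α γ c : ℝ}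
    (ht : t ∈ stdSimplex ℝ X) (hy : y ∈ stdSimplex ℝ X) (hp : 0 ≤ p) (htp : support t ⊆ support p)
    (hη : η ∈ Set.Ioo (0 : ℝ) 1) (hα : 0 < α)
    (hC : chernoffCoeff η (mix t y α) p < Real.exp (-(η * γ + (1 - η) * c)))
    (hG : GJS t y α < γ * α) : c < relEntropy t p := by
  have hm := mix_mem_stdSimplex ht hy hα.le
  have htm := support_subset_mix_left ht.1 hy.1 hα
  have hDt : relEntropy t (mix t y α) < γ := by
    have hDy := relEntropy_nonneg hy hm (support_subset_mix_right ht.1 hy.1 hα.le)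
    rw [GJS_eq_mix] at hG
    nlinarith
  have hsum : η * γ + (1 - η) * c < η * relEntropy t (mix t y α) + (1 - η) * relEntropy t p := by
    rw [← neg_lt_neg_iff, ← Real.exp_lt_exp]
    exact (exp_neg_le_chernoffCoeff ht hm.1 hp htm htp η).trans_lt hC
  have hη1 : 0 < 1 - η := sub_pos.2 hη.2
  have hηγ := mul_le_mul_of_nonneg_left hDt.le hη.1.le
  exact lt_of_mul_lt_mul_left (by linarith) hη1.le

theorem prod_measure_le_add {Ω Ω' : Type*} [MeasurableSpace Ω] [MeasurableSpace Ω']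
    (μ : Measure Ω) (ν : Measure Ω') [IsProbabilityMeasure μ] [IsProbabilityMeasure ν]
    {s : Set (Ω × Ω')} {A : Set Ω} {B : Set Ω'} (hs : ∀ x y, (x, y) ∈ s → x ∈ A ∨ y ∈ B) :
    μ.prod ν s ≤ μ A + ν B := by
  have hsub : s ⊆ A ×ˢ Set.univ ∪ Set.univ ×ˢ B := fun z hz => by
    simpa using hs z.1 z.2 hz
  calc μ.prod ν s ≤ μ.prod ν (A ×ˢ Set.univ) + μ.prod ν (Set.univ ×ˢ B) :=
        (measure_mono hsub).trans (measure_union_le _ _)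
    _ = μ A + ν B := by rw [Measure.prod_prod, Measure.prod_prod, measure_univ, measure_univ,
        mul_one, one_mul]

theorem score_lt_iff {X : Type*} [Fintype X] {N n : ℕ} (hn : 0 < n) (x : Fin N → X)
    (y : Fin n → X) (γ : ℝ) :
    score x y < γ * N ↔ GJS (empirical x) (empirical y) (N / n) < γ * (N / n) := by
  have hn' : (0 : ℝ) < n := Nat.cast_pos.2 hn
  rw [score, ← mul_div_assoc, lt_div_iff₀ hn', mul_comm (n : ℝ)]

section Rates

variable {X : Type*} [Fintype X] [MeasurableSpace X]

theorem exists_eventually_score_lt_sq_le (P Q : PMF X) {η γ c : ℝ} (hη : η ∈ Set.Ioo (0 : ℝ) 1)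
    (hC : chernoffCoeff η (pmfReal Q) (pmfReal P) < Real.exp (-(η * γ + (1 - η) * c))) :
    ∃ ε > 0, ∀ᶠ N : ℕ in atTop, (wordLaw P N).prod (wordLaw Q (N ^ 2))
      {z | score z.1 z.2 < γ * N} ≤
        wordLaw P N {x | support (empirical x) ⊆ support (pmfReal P) →
          c ≤ relEntropy (empirical x) (pmfReal P)} +
        wordLaw Q (N ^ 2) {y | ε ≤ dist (empirical y) (pmfReal Q)} := by
  obtain ⟨ε, hε, hball⟩ := Metric.eventually_nhds_iff.1
    (((continuous_chernoffCoeff hη.1.le (pmfReal P)).tendsto _).eventually_lt_const hC)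
  have hε2 : 0 < ε / 2 := half_pos hε
  refine ⟨ε / 2, hε2, ?_⟩
  filter_upwards [eventually_gt_atTop 0,
    tendsto_one_div_atTop_nhds_zero_nat.eventually_lt_const hε2] with N hN hNε
  have hsqN : 0 < N ^ 2 := by positivity
  have hα : (N : ℝ) / (N ^ 2 : ℕ) = 1 / N := by
    push_cast
    field_simp
  refine prod_measure_le_add _ _ fun x y hxy => or_iff_not_imp_right.2 fun hy hx => ?_
  have hx' := empirical_mem_stdSimplex hN x
  have hy' := empirical_mem_stdSimplex hsqN y
  rw [Set.mem_ofPred_eq, score_lt_iff hsqN, hα] at hxy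
  refine (lt_relEntropy_of_GJS_lt hx' hy' (pmfReal_mem_stdSimplex P).1 hx hη (by positivity)
    (hball ?_) hxy).le
  calc _ ≤ dist (mix (empirical x) (empirical y) (1 / N)) (empirical y) +
        dist (empirical y) (pmfReal Q) := dist_triangle _ _ _
    _ < ε / 2 + ε / 2 :=
      add_lt_add ((dist_mix_le hx' hy' (by positivity)).trans_lt hNε) (not_le.1 hy)
    _ = ε := add_halves ε

variable [MeasurableSingletonClass X]

theorem expGrowthSup_le_dist_empirical_le (P : PMF X) {ε t : ℝ} (hε : 0 < ε) {n : ℕ → ℕ}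
    (hn : ∀ᶠ N : ℕ in atTop, t * N ≤ n N) :
    expGrowthSup (fun N => wordLaw P (n N) {y | ε ≤ dist (empirical y) (pmfReal P)}) ≤
      ((-(2 * ε ^ 2 * t) : ℝ) : EReal) := by
  refine expGrowthSup_le_of_eventually_le_pow_mul_exp (C := 2 * Fintype.card X) (m := 0)
    (by positivity) ?_
  filter_upwards [hn] with N hN
  rw [← ofReal_measureReal, pow_zero, mul_one]
  refine ENNReal.ofReal_le_ofReal ((wordLaw_le_dist_empirical_le P (n N) hε).trans ?_)
  rw [mul_assoc (2 * ε ^ 2)]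
  gcongr

theorem expGrowthSup_le_relEntropy_le (P : PMF X) (c : ℝ) :
    expGrowthSup (fun N => wordLaw P N {x | support (empirical x) ⊆ support (pmfReal P) →
      c ≤ relEntropy (empirical x) (pmfReal P)}) ≤ ((-c : ℝ) : EReal) := by
  refine expGrowthSup_le_of_eventually_le_pow_mul_exp (C := 1) (m := Fintype.card X) one_pos.le ?_
  filter_upwards [eventually_gt_atTop 0] with N hN
  rw [← ofReal_measureReal, one_mul, mul_comm c]
  exact ENNReal.ofReal_le_ofReal (wordLaw_le_relEntropy_le P hN c)

theorem expGrowthSup_sum_le_score_le (P : PMF X) (γ : ℝ) :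
    expGrowthSup (fun N => ∑ n ∈ Finset.Icc 1 (N ^ 2),
      (wordLaw P N).prod (wordLaw P n) {z | γ * N ≤ score z.1 z.2}) ≤ ((-γ : ℝ) : EReal) := by
  let k := Fintype.card X
  refine expGrowthSup_le_of_eventually_le_pow_mul_exp (C := 1) (m := 2 + (k + 2 * k)) one_pos.le ?_
  filter_upwards [eventually_gt_atTop 0] with N hN
  have hterm : ∀ n ∈ Finset.Icc 1 (N ^ 2),
      (wordLaw P N).prod (wordLaw P n) {z | γ * N ≤ score z.1 z.2} ≤
        ENNReal.ofReal (((N : ℝ) + 1) ^ (k + 2 * k) * Real.exp (-(γ * N))) := by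
    intro n hn
    rw [Finset.mem_Icc] at hn
    have hn2 : (n : ℝ) + 1 ≤ ((N : ℝ) + 1) ^ 2 := by
      have : (n : ℝ) ≤ (N : ℝ) ^ 2 := by exact_mod_cast hn.2
      nlinarith [N.cast_nonneg (α := ℝ)]
    rw [← ofReal_measureReal, pow_add, pow_mul]
    refine ENNReal.ofReal_le_ofReal ((wordLaw_prod_le_score_le P hN hn.1 _).trans ?_)
    gcongr
  refine (Finset.sum_le_sum hterm).trans ?_
  rw [Finset.sum_const, Nat.card_Icc, add_tsub_cancel_right, ← ENNReal.ofReal_nsmul, one_mul,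
    pow_add _ 2, mul_assoc, nsmul_eq_mul, Nat.cast_pow]
  gcongr
  linarith

theorem expGrowthSup_score_lt_sq_le (P Q : PMF X) {η γ : ℝ} (hη : η ∈ Set.Ioo (0 : ℝ) 1)
    (hC : chernoffCoeff η (pmfReal Q) (pmfReal P) ≤ Real.exp (-γ)) :
    expGrowthSup (fun N => (wordLaw P N).prod (wordLaw Q (N ^ 2))
      {z | score z.1 z.2 < γ * N}) ≤ ((-γ : ℝ) : EReal) := by
  refine EReal.le_of_forall_lt_iff_le.1 fun b hb => ?_
  obtain ⟨c, rfl⟩ : ∃ c, b = -c := ⟨-b, (neg_neg b).symm⟩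
  have hcγ : c < γ := neg_lt_neg_iff.1 (EReal.coe_lt_coe_iff.1 hb)
  have hCc : chernoffCoeff η (pmfReal Q) (pmfReal P) < Real.exp (-(η * γ + (1 - η) * c)) :=
    hC.trans_lt (Real.exp_lt_exp.2 (by nlinarith [hη.2]))
  obtain ⟨ε, hε, hsplit⟩ := exists_eventually_score_lt_sq_le P Q hη hCc
  let t := γ / (2 * ε ^ 2)
  have ht : 2 * ε ^ 2 * t = γ := mul_div_cancel₀ _ (by positivity)
  have hsq : ∀ᶠ N : ℕ in atTop, t * N ≤ (N ^ 2 : ℕ) := by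
    filter_upwards [tendsto_natCast_atTop_atTop.eventually_ge_atTop t] with N hN
    rw [Nat.cast_pow, sq]
    gcongr
  refine (expGrowthSup_eventually_monotone hsplit).trans (expGrowthSup_add.trans_le (sup_le
    (expGrowthSup_le_relEntropy_le P c) ((expGrowthSup_le_dist_empirical_le Q hε hsq).trans ?_)))
  rw [ht]
  exact hb.le

theorem expGrowthSup_score_lt_ceil_neg (P Q : PMF X) {γ t : ℝ} (ht : 0 < t)
    (hG : γ * t⁻¹ < GJS (pmfReal P) (pmfReal Q) t⁻¹) :
    expGrowthSup (fun N => (wordLaw P N).prod (wordLaw Q ⌈t * N⌉₊)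
      {z | score z.1 z.2 < γ * N}) < 0 := by
  have hP := (pmfReal_mem_stdSimplex P).1
  have hQ := (pmfReal_mem_stdSimplex Q).1
  let S : Set ((X → ℝ) × (X → ℝ) × ℝ) := Set.Ici 0 ×ˢ Set.Ici 0 ×ˢ Set.Ioi 0
  have hcont : ContinuousOn (fun z : (X → ℝ) × (X → ℝ) × ℝ => GJS z.1 z.2.1 z.2.2 - γ * z.2.2) S :=
    continuousOn_GJS.sub (by fun_prop)
  obtain ⟨ε, hε, hball⟩ := Metric.mem_nhdsWithin_iff.1
    ((hcont (pmfReal P, pmfReal Q, t⁻¹) ⟨hP, hQ, inv_pos.2 ht⟩).eventually_const_lt (sub_pos.2 hG))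
  have hratio : Tendsto (fun N : ℕ => (N : ℝ) / ⌈t * N⌉₊) atTop (𝓝 t⁻¹) :=
    (((tendsto_nat_ceil_mul_div_atTop ht.le).comp
      (tendsto_natCast_atTop_atTop (R := ℝ))).inv₀ ht.ne').congr fun N => inv_div _ _
  have hsplit : ∀ᶠ N : ℕ in atTop, (wordLaw P N).prod (wordLaw Q ⌈t * N⌉₊)
      {z | score z.1 z.2 < γ * N} ≤ wordLaw P N {x | ε ≤ dist (empirical x) (pmfReal P)} +
        wordLaw Q ⌈t * N⌉₊ {y | ε ≤ dist (empirical y) (pmfReal Q)} := by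
    filter_upwards [eventually_gt_atTop 0, hratio.eventually (Metric.ball_mem_nhds _ hε)]
      with N hN hNε
    have hceil : 0 < ⌈t * N⌉₊ := by positivity
    refine prod_measure_le_add _ _ fun x y hxy => ?_
    rw [Set.mem_ofPred_eq, score_lt_iff hceil] at hxy
    by_contra! hnear
    have hmem : (empirical x, empirical y, (N : ℝ) / ⌈t * N⌉₊) ∈
        Metric.ball (pmfReal P, pmfReal Q, t⁻¹) ε ∩ S :=
      ⟨max_lt (not_le.1 hnear.1) (max_lt (not_le.1 hnear.2) hNε),
        empirical_nonneg x, empirical_nonneg y,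
        Set.mem_Ioi.2 (div_pos (Nat.cast_pos.2 hN) (Nat.cast_pos.2 hceil))⟩
    exact hxy.not_gt (sub_pos.1 (hball hmem))
  refine (expGrowthSup_eventually_monotone hsplit).trans_lt (expGrowthSup_add.trans_lt (max_lt
    ((expGrowthSup_le_dist_empirical_le P (t := 1) hε (by simp)).trans_lt ?_)
    ((expGrowthSup_le_dist_empirical_le Q hε
      (Eventually.of_forall fun N => Nat.le_ceil _)).trans_lt ?_))) <;>
  · rw [← EReal.coe_zero, EReal.coe_lt_coe_iff, neg_lt_zero]
    positivity

end Rates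

section Law

variable {X : Type*} [MeasurableSpace X]

theorem initial_preimage_pi {A : Type*} (n : ℕ) (s : Fin n → Set A) :
    initial n ⁻¹' Set.univ.pi s =
      Set.pi (Finset.range n) fun k => if h : k < n then s ⟨k, h⟩ else Set.univ := by
  ext y
  simp only [Set.mem_preimage, Set.mem_pi, Set.mem_univ, forall_const, Finset.coe_range,
    Set.mem_Iio, initial]
  refine ⟨fun h k hk => ?_, fun h k => ?_⟩
  · rw [dif_pos hk]
    exact h ⟨k, hk⟩
  · simpa only [dif_pos k.2] using h k k.2

theorem measurePreserving_initial (P : PMF X) (n : ℕ) :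
    MeasurePreserving (initial n) (Measure.infinitePi fun _ : ℕ => P.toMeasure) (wordLaw P n) := by
  have hmeas : Measurable (initial n : (ℕ → X) → Fin n → X) :=
    measurable_pi_lambda _ fun k => measurable_pi_apply (k : ℕ)
  refine ⟨hmeas, (Measure.pi_eq fun s hs => ?_).symm⟩
  rw [Measure.map_apply hmeas (MeasurableSet.univ_pi hs), initial_preimage_pi,
    Measure.infinitePi_pi _ fun k hk => ?_, Finset.prod_range]
  · simp only [Fin.is_lt, dite_true, Fin.eta]
  · rw [dif_pos (Finset.mem_range.1 hk)]
    exact hs _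

instance isProbabilityMeasure_law (P₁ P₂ : PMF X) (i : Hyp) (N : ℕ) :
    IsProbabilityMeasure (law P₁ P₂ i N) := by
  unfold law
  infer_instance

variable [Finite X] [MeasurableSingletonClass X]

theorem law_initial_left (P₁ P₂ : PMF X) (i : Hyp) (N n : ℕ) (s : Set ((Fin N → X) × (Fin n → X))) :
    law P₁ P₂ i N {ω | (ω.1, initial n ω.2.2) ∈ s} =
      (wordLaw P₁ N).prod (wordLaw (i.source P₁ P₂) n) s :=
  ((MeasurePreserving.id (wordLaw P₁ N)).prod ((measurePreserving_initial _ n).comp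
    (measurePreserving_snd (μ := wordLaw P₂ N)))).measure_preimage
      (MeasurableSet.of_discrete (s := s)).nullMeasurableSet

theorem law_initial_right (P₁ P₂ : PMF X) (i : Hyp) (N n : ℕ)
    (s : Set ((Fin N → X) × (Fin n → X))) :
    law P₁ P₂ i N {ω | (ω.2.1, initial n ω.2.2) ∈ s} =
      (wordLaw P₂ N).prod (wordLaw (i.source P₁ P₂) n) s :=
  (((MeasurePreserving.id (wordLaw P₂ N)).prod (measurePreserving_initial _ n)).comp
    (measurePreserving_snd (μ := wordLaw P₁ N))).measure_preimage
      (MeasurableSet.of_discrete (s := s)).nullMeasurableSet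

end Law

section StoppingTime

variable {X : Type*} [Fintype X] {N : ℕ} {γ : ℝ}

theorem seqTime_swap (γ : ℝ) (x₁ x₂ : Fin N → X) (y : ℕ → X) :
    seqTime γ x₁ x₂ y = seqTime γ x₂ x₁ y := by
  simp only [seqTime, crossings, or_comm]

theorem seqTime_mem (γ : ℝ) (x₁ x₂ : Fin N → X) (y : ℕ → X) :
    seqTime γ x₁ x₂ y ∈ insert (N ^ 2) (crossings γ x₁ x₂ y) :=
  Nat.sInf_mem (Set.insert_nonempty _ _)

theorem seqTime_le_sq (x₁ x₂ : Fin N → X) (y : ℕ → X) : seqTime γ x₁ x₂ y ≤ N ^ 2 :=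
  Nat.sInf_le (Set.mem_insert _ _)

theorem seqTime_pos (hN : 0 < N) (x₁ x₂ : Fin N → X) (y : ℕ → X) : 0 < seqTime γ x₁ x₂ y := by
  rcases seqTime_mem γ x₁ x₂ y with h | h
  · rw [h]
    positivity
  · exact h.1

theorem seqTime_le_of_le_score_right {n : ℕ} (hn : 0 < n) {x₁ x₂ : Fin N → X} {y : ℕ → X}
    (h : γ * N ≤ score x₂ (initial n y)) : seqTime γ x₁ x₂ y ≤ n :=
  Nat.sInf_le (Set.mem_insert_of_mem _ ⟨hn, Or.inr h⟩)

theorem le_score_seqTime {x₁ x₂ : Fin N → X} {y : ℕ → X}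
    (h1 : score x₁ (initial (seqTime γ x₁ x₂ y) y) < γ * N)
    (h2 : γ * N ≤ score x₂ (initial (N ^ 2) y)) :
    γ * N ≤ score x₂ (initial (seqTime γ x₁ x₂ y) y) := by
  rcases seqTime_mem γ x₁ x₂ y with h | h
  · rwa [h]
  · exact h.2.resolve_left h1.not_ge

theorem IsSeqRule.eq_H1_of_score
    {d : (Fin N → X) → (Fin N → X) → (n : ℕ) → (Fin n → X) → Hyp} (hd : IsSeqRule γ d)
    (hN : 0 < N) {x₁ x₂ : Fin N → X} {y : ℕ → X}
    (h1 : ∀ n ∈ Finset.Icc 1 (N ^ 2), score x₁ (initial n y) < γ * N)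
    (h2 : γ * N ≤ score x₂ (initial (N ^ 2) y)) :
    d x₁ x₂ (seqTime γ x₁ x₂ y) (initial (seqTime γ x₁ x₂ y) y) = .H1 := by
  have hT := h1 _ (Finset.mem_Icc.2 ⟨seqTime_pos (γ := γ) hN x₁ x₂ y, seqTime_le_sq x₁ x₂ y⟩)
  exact (hd _ _ _ _).1 (le_score_seqTime hT h2) hT.not_ge

end StoppingTime

section Test

variable {X : Type*} [Fintype X] [MeasurableSpace X] (P₁ P₂ : PMF X) (γ : ℝ) {N : ℕ}
  (d : (Fin N → X) → (Fin N → X) → (n : ℕ) → (Fin n → X) → Hyp)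

theorem expectedTime_seqTest_pos (hN : 0 < N) : 0 < expectedTime P₁ P₂ .H1 (seqTest γ d) := by
  calc (0 : ℝ≥0∞) < ∫⁻ _, 1 ∂law P₁ P₂ .H1 N := by simp
    _ ≤ expectedTime P₁ P₂ .H1 (seqTest γ d) :=
      lintegral_mono fun ω => Nat.one_le_cast.2 (seqTime_pos (γ := γ) hN ω.1 ω.2.1 ω.2.2)

variable [MeasurableSingletonClass X]

theorem expectedTime_seqTest_le {n : ℕ} (hn : 0 < n) :
    expectedTime P₁ P₂ .H1 (seqTest γ d) ≤ n + (N : ℝ≥0∞) ^ 2 *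
      (wordLaw P₂ N).prod (wordLaw P₁ n) {z | score z.1 z.2 < γ * N} := by
  let F : Set ((Fin N → X) × (Fin N → X) × (ℕ → X)) :=
    {ω | score ω.2.1 (initial n ω.2.2) < γ * N}
  have htime (ω : (Fin N → X) × (Fin N → X) × (ℕ → X)) :
      (seqTime γ ω.1 ω.2.1 ω.2.2 : ℝ≥0∞) ≤ n + F.indicator (fun _ => (N : ℝ≥0∞) ^ 2) ω := by
    by_cases hω : ω ∈ F
    · rw [Set.indicator_of_mem hω]
      exact le_add_left (by exact_mod_cast seqTime_le_sq ω.1 ω.2.1 ω.2.2)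
    · rw [Set.indicator_of_notMem hω, add_zero]
      exact Nat.cast_le.2 (seqTime_le_of_le_score_right hn (not_lt.1 hω))
  calc expectedTime P₁ P₂ .H1 (seqTest γ d)
      ≤ ∫⁻ ω, (n + F.indicator (fun _ => (N : ℝ≥0∞) ^ 2) ω) ∂law P₁ P₂ .H1 N :=
        lintegral_mono htime
    _ ≤ n + (N : ℝ≥0∞) ^ 2 * law P₁ P₂ .H1 N F := by
        rw [lintegral_add_left measurable_const, lintegral_const, measure_univ, mul_one]
        gcongr
        exact lintegral_indicator_const_le _ _
    _ = _ := congrArg (n + (N : ℝ≥0∞) ^ 2 * ·)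
        (law_initial_right P₁ P₂ .H1 N n {z | score z.1 z.2 < γ * N})

variable {γ d}

theorem errorProb_seqTest_le (hN : 0 < N) (hd : IsSeqRule γ d) :
    errorProb P₁ P₂ .H1 (seqTest γ d) ≤
      ∑ n ∈ Finset.Icc 1 (N ^ 2), (wordLaw P₁ N).prod (wordLaw P₁ n) {z | γ * N ≤ score z.1 z.2} +
        (wordLaw P₂ N).prod (wordLaw P₁ (N ^ 2)) {z | score z.1 z.2 < γ * N} := by
  let E (n : ℕ) : Set ((Fin N → X) × (Fin N → X) × (ℕ → X)) :=
    {ω | γ * N ≤ score ω.1 (initial n ω.2.2)}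
  let F : Set ((Fin N → X) × (Fin N → X) × (ℕ → X)) :=
    {ω | score ω.2.1 (initial (N ^ 2) ω.2.2) < γ * N}
  have hsub : {ω : (Fin N → X) × (Fin N → X) × (ℕ → X) | d ω.1 ω.2.1 (seqTime γ ω.1 ω.2.1 ω.2.2)
      (initial (seqTime γ ω.1 ω.2.1 ω.2.2) ω.2.2) ≠ .H1} ⊆
        (⋃ n ∈ Finset.Icc 1 (N ^ 2), E n) ∪ F := by
    intro ω hω
    by_contra hc
    simp only [Set.mem_union, Set.mem_iUnion, not_or, not_exists, E, F, Set.mem_ofPred_eq, not_le,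
      not_lt] at hc
    exact hω (hd.eq_H1_of_score hN hc.1 hc.2)
  have hE (n : ℕ) : law P₁ P₂ .H1 N (E n) =
      (wordLaw P₁ N).prod (wordLaw P₁ n) {z | γ * N ≤ score z.1 z.2} :=
    law_initial_left P₁ P₂ .H1 N n {z | γ * N ≤ score z.1 z.2}
  have hF : law P₁ P₂ .H1 N F =
      (wordLaw P₂ N).prod (wordLaw P₁ (N ^ 2)) {z | score z.1 z.2 < γ * N} :=
    law_initial_right P₁ P₂ .H1 N (N ^ 2) {z | score z.1 z.2 < γ * N}
  simp only [← hE, ← hF]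
  exact (measure_mono hsub).trans ((measure_union_le _ _).trans
    (add_le_add_left (measure_biUnion_finset_le _ _) _))

end Test

section Exponent

variable {X : Type*} [Fintype X] [MeasurableSpace X] [MeasurableSingletonClass X]
  {P₁ P₂ : PMF X} {η γ β : ℝ}
  {d : (N : ℕ) → (Fin N → X) → (Fin N → X) → (n : ℕ) → (Fin n → X) → Hyp}

theorem expGrowthSup_errorProb_seqTest_le (hη : η ∈ Set.Ioo (0 : ℝ) 1)
    (hC : chernoffCoeff η (pmfReal P₁) (pmfReal P₂) ≤ Real.exp (-γ))
    (hd : ∀ N, IsSeqRule γ (d N)) :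
    expGrowthSup (fun N => errorProb P₁ P₂ .H1 (seqTest γ (d N))) ≤ ((-γ : ℝ) : EReal) := by
  refine (expGrowthSup_eventually_monotone ?_).trans (expGrowthSup_add.trans_le
    (sup_le (expGrowthSup_sum_le_score_le P₁ γ) (expGrowthSup_score_lt_sq_le P₂ P₁ hη hC)))
  filter_upwards [eventually_gt_atTop 0] with N hN
  exact errorProb_seqTest_le P₁ P₂ hN (hd N)

theorem linearGrowthSup_expectedTime_seqTest_le (hne : pmfReal P₂ ≠ pmfReal P₁) (hβ : 0 < β)
    (hsol : GJS (pmfReal P₂) (pmfReal P₁) β = γ * β) :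
    linearGrowthSup (fun N => (expectedTime P₁ P₂ .H1 (seqTest γ (d N)) : EReal)) ≤
      ((β⁻¹ : ℝ) : EReal) := by
  refine EReal.le_of_forall_lt_iff_le.1 fun t ht => ?_
  have hβt : β⁻¹ < t := EReal.coe_lt_coe_iff.1 ht
  have ht0 : 0 < t := (inv_pos.2 hβ).trans hβt
  refine linearGrowthSup_le_of_le_ceil_add ht0.le (expGrowthSup_score_lt_ceil_neg P₂ P₁ ht0
    (mul_lt_GJS_of_lt (pmfReal_mem_stdSimplex P₂) (pmfReal_mem_stdSimplex P₁) hne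
      (inv_pos.2 ht0) (inv_lt_of_inv_lt₀ hβ hβt) hsol)) ?_
  filter_upwards [eventually_gt_atTop 0] with N hN
  exact expectedTime_seqTest_le P₁ P₂ γ (d N) (by positivity)

theorem tendsto_errorProb_seqTest (hη : η ∈ Set.Ioo (0 : ℝ) 1) (hγ : 0 < γ)
    (hC : chernoffCoeff η (pmfReal P₁) (pmfReal P₂) ≤ Real.exp (-γ))
    (hd : ∀ N, IsSeqRule γ (d N)) :
    Tendsto (fun N => errorProb P₁ P₂ .H1 (seqTest γ (d N))) atTop (𝓝 0) :=
  tendsto_zero_of_expGrowthSup_neg ((expGrowthSup_errorProb_seqTest_le hη hC hd).trans_lt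
    (by exact_mod_cast neg_lt_zero.2 hγ))

theorem GJS_le_errorExponent_seqTest (hη : η ∈ Set.Ioo (0 : ℝ) 1) (hγ : 0 < γ)
    (hC : chernoffCoeff η (pmfReal P₁) (pmfReal P₂) ≤ Real.exp (-γ)) (hβ : 0 < β)
    (hsol : GJS (pmfReal P₂) (pmfReal P₁) β = γ * β) (hd : ∀ N, IsSeqRule γ (d N)) :
    ((GJS (pmfReal P₂) (pmfReal P₁) β : ℝ) : EReal) ≤
      errorExponent P₁ P₂ .H1 fun N => seqTest γ (d N) := by
  have hne : pmfReal P₂ ≠ pmfReal P₁ := ne_of_chernoffCoeff_lt_one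
    (pmfReal_mem_stdSimplex _) (hC.trans_lt (by simpa using hγ))
  rw [hsol, ← div_inv_eq_mul]
  refine le_liminf_neg_log_div hγ (inv_pos.2 hβ) (expGrowthSup_errorProb_seqTest_le hη hC hd)
    (linearGrowthSup_expectedTime_seqTest_le hne hβ hsol) ?_
  filter_upwards [eventually_gt_atTop 0] with N hN
  exact expectedTime_seqTest_pos P₁ P₂ γ (d N) hN

end Exponent

section Swap

/-- The hypothesis in which the two training sequences have exchanged their roles. -/
def Hyp.swap : Hyp → Hyp
  | H1 => H2
  | H2 => H1

/-- The decision rule that exchanges the two training words and then decides as `d` does, with the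
names of the hypotheses exchanged accordingly. It reduces statements on `H2` to `H1`. -/
def swapRule {A : Type*} {N : ℕ} (d : (Fin N → A) → (Fin N → A) → (n : ℕ) → (Fin n → A) → Hyp) :
    (Fin N → A) → (Fin N → A) → (n : ℕ) → (Fin n → A) → Hyp :=
  fun x₁ x₂ n y => (d x₂ x₁ n y).swap

theorem Hyp.swap_eq_H1 {i : Hyp} : i.swap = H1 ↔ i = H2 := by
  cases i <;> simp [Hyp.swap]

theorem measurePreserving_law_swap {X : Type*} [MeasurableSpace X] (P₁ P₂ : PMF X) (N : ℕ) :
    MeasurePreserving (MeasurableEquiv.prodAssoc.symm.trans ((MeasurableEquiv.prodComm.prodCongr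
      (.refl _)).trans MeasurableEquiv.prodAssoc)) (law P₁ P₂ .H2 N) (law P₂ P₁ .H1 N) :=
  (measurePreserving_prodAssoc _ _ _).comp ((Measure.measurePreserving_swap.prod (.id _)).comp
    (measurePreserving_prodAssoc _ _ _).symm)

variable {X : Type*} [Fintype X] {N : ℕ} {γ : ℝ}
  {d : (Fin N → X) → (Fin N → X) → (n : ℕ) → (Fin n → X) → Hyp}

theorem IsSeqRule.swapRule (hd : IsSeqRule γ d) : IsSeqRule γ (swapRule d) := fun x₁ x₂ n y =>
  ⟨fun h2 h1 => by simp only [SeqClass.swapRule, (hd x₂ x₁ n y).2 h2 h1, Hyp.swap],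
    fun h1 h2 => by simp only [SeqClass.swapRule, (hd x₂ x₁ n y).1 h1 h2, Hyp.swap]⟩

variable [MeasurableSpace X]

theorem errorProb_seqTest_swapRule (P₁ P₂ : PMF X) :
    errorProb P₂ P₁ .H1 (seqTest γ (swapRule d)) = errorProb P₁ P₂ .H2 (seqTest γ d) := by
  unfold errorProb
  rw [← (measurePreserving_law_swap P₁ P₂ N).measure_preimage_equiv]
  congr 1
  ext ω
  change (d ω.1 ω.2.1 (seqTime γ ω.2.1 ω.1 ω.2.2) (initial _ ω.2.2)).swap ≠ .H1 ↔
    d ω.1 ω.2.1 (seqTime γ ω.1 ω.2.1 ω.2.2) (initial _ ω.2.2) ≠ .H2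
  rw [Ne, Hyp.swap_eq_H1, seqTime_swap]

theorem expectedTime_seqTest_swapRule (P₁ P₂ : PMF X) :
    expectedTime P₂ P₁ .H1 (seqTest γ (swapRule d)) = expectedTime P₁ P₂ .H2 (seqTest γ d) := by
  unfold expectedTime
  rw [← (measurePreserving_law_swap P₁ P₂ N).lintegral_comp_emb
    (MeasurableEquiv.measurableEmbedding _)]
  refine lintegral_congr fun ω => congrArg Nat.cast ?_
  exact seqTime_swap γ ω.2.1 ω.1 ω.2.2

theorem errorExponent_seqTest_swapRule (P₁ P₂ : PMF X)
    {d : (N : ℕ) → (Fin N → X) → (Fin N → X) → (n : ℕ) → (Fin n → X) → Hyp} :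
    errorExponent P₂ P₁ .H1 (fun N => seqTest γ (swapRule (d N))) =
      errorExponent P₁ P₂ .H2 fun N => seqTest γ (d N) := by
  simp only [errorExponent, errorProb_seqTest_swapRule, expectedTime_seqTest_swapRule]

end Swap

end SeqClass

end

theorem corollary1 {X : Type*} [Fintype X] [MeasurableSpace X] [MeasurableSingletonClass X]
    (P₁ P₂ : PMF X) (γ : ℝ) (hγ : 0 < γ) (hγC : (γ : EReal) ≤ SeqClass.chernoff P₁ P₂)
    (hsupp : (γ : EReal) = SeqClass.chernoff P₁ P₂ → P₁.support = P₂.support) :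
    ∃ β θ : ℝ, SeqClass.IsTheSolution P₂ P₁ γ β ∧ SeqClass.IsTheSolution P₁ P₂ γ θ ∧
      ∀ d : (N : ℕ) → (Fin N → X) → (Fin N → X) → (n : ℕ) → (Fin n → X) → SeqClass.Hyp,
        (∀ N : ℕ, SeqClass.IsSeqRule γ (d N)) →
        (Tendsto (fun N => SeqClass.errorProb P₁ P₂ SeqClass.Hyp.H1 (SeqClass.seqTest γ (d N)))
            atTop (𝓝 0) ∧
          ((SeqClass.GJS (SeqClass.pmfReal P₂) (SeqClass.pmfReal P₁) β : ℝ) : EReal) ≤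
            SeqClass.errorExponent P₁ P₂ SeqClass.Hyp.H1
              (fun N => SeqClass.seqTest γ (d N))) ∧
        (Tendsto (fun N => SeqClass.errorProb P₁ P₂ SeqClass.Hyp.H2 (SeqClass.seqTest γ (d N)))
            atTop (𝓝 0) ∧
          ((SeqClass.GJS (SeqClass.pmfReal P₁) (SeqClass.pmfReal P₂) θ : ℝ) : EReal) ≤
            SeqClass.errorExponent P₁ P₂ SeqClass.Hyp.H2
              (fun N => SeqClass.seqTest γ (d N))) := by
  obtain ⟨η, hη, hC⟩ := SeqClass.exists_chernoffCoeff_le hγ hγC hsupp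
  have hη' : 1 - η ∈ Set.Ioo (0 : ℝ) 1 := ⟨sub_pos.2 hη.2, sub_lt_self 1 hη.1⟩
  have hC' := SeqClass.chernoffCoeff_symm η (SeqClass.pmfReal P₂) (SeqClass.pmfReal P₁) ▸ hC
  have hexp {s : ℝ} (hs : s ∈ Set.Ioo (0 : ℝ) 1) : Real.exp (-γ) < Real.exp (-(s * γ)) :=
    Real.exp_lt_exp.2 (neg_lt_neg (mul_lt_of_lt_one_left hγ hs.2))
  obtain ⟨β, hβ⟩ := SeqClass.exists_isTheSolution hη.1 hγ (hC.trans_lt (hexp hη))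
  obtain ⟨θ, hθ⟩ := SeqClass.exists_isTheSolution hη'.1 hγ (hC'.trans_lt (hexp hη'))
  refine ⟨β, θ, hβ, hθ, fun d hd => ⟨⟨?_, ?_⟩, ?_, ?_⟩⟩
  · exact SeqClass.tendsto_errorProb_seqTest hη hγ hC hd
  · exact SeqClass.GJS_le_errorExponent_seqTest hη hγ hC hβ.1 hβ.2.1 hd
  · simp only [← SeqClass.errorProb_seqTest_swapRule]
    exact SeqClass.tendsto_errorProb_seqTest hη' hγ hC' fun N => (hd N).swapRule
  · rw [← SeqClass.errorExponent_seqTest_swapRule]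
    exact SeqClass.GJS_le_errorExponent_seqTest hη' hγ hC' hθ.1 hθ.2.1 fun N => (hd N).swapRule
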